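/- Let operators act on $\mathbb{C}^2\otimes\mathbb{C}^2$ (Alice $\otimes$ Bob). A state is a positive semidefinite operator of unit trace. A two-qubit entanglement witness is a Hermitian operator $W$ of unit trace with $\langle\psi|W|\psi\rangle\ge 0$ for all product vectors $\psi=\phi\otimes\nu$ that is not positive semidefinite. A witness $W$ detects a state $\rho$ if $\mathrm{tr}(\rho W)<0$; a witness $W_1$ is finer than $W_2$ if every state detected by $W_2$ is detected by $W_1$; $W$ is optimal if no witness other than $W$ itself is finer than $W$; $W$ is weakly optimal if $\langle\psi|W|\psi\rangle=0$ for some $\psi=\phi\otimes\nu$ with $\phi,\nu$ unit vectors. With the Pauli matrices $\sigma_1,\sigma_2,\sigma_3$, put $a_i=\mathrm{tr}(W\,\sigma_i\otimes 1)$, $b_j=\mathrm{tr}(W\,1\otimes\sigma_j)$, $T_{ij}=\mathrm{tr}(W\,\sigma_i\otimes\sigma_j)$. A witness always has $|b|<1$. Let $\gamma^2=1/(1-|b|^2)$, $$c=\gamma^2(a-Tb),\qquad Q=\gamma^2\,(T-ab^{\mathrm T})(1+\gamma^2 bb^{\mathrm T})(T^{\mathrm T}-ba^{\mathrm T}).$$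 The ellipsoid of $W$ is the (solid, possibly degenerate) ellipsoid $\mathcal{E}=\{c+Q^{1/2}u: u\in\mathbb{R}^3,\ |u|\le 1\}$. Its chirality is $\chi=\mathrm{sign}(\det\widetilde T)$, where $\widetilde T_{ij}=\mathrm{tr}(\widetilde W\,\sigma_i\otimes\sigma_j)$, $\widetilde W=\big(1\otimes (2W_B)^{-1/2}\big)\,W\,\big(1\otimes (2W_B)^{-1/2}\big)$ and $W_B=\mathrm{tr}_A W$ is the partial trace of $W$ over the first factor; $\mathcal{E}$ is right-handed if $\chi=+1$. Theorem 4. Let $W$ be a two-qubit entanglement witness with ellipsoid $\mathcal{E}$. Then (i) $W$ is optimal if and only if $\mathcal{E}$ is the whole closed unit ball of $\mathbb{R}^3$ and is right-handed ($\chi=+1$); (ii) $W$ is weakly optimal if and only if $\mathcal{E}$ touches the unit sphere, i.e. $\mathcal{E}$ contains a point $x$ with $|x|=1$. -/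

import Mathlib

open scoped ComplexOrder Kronecker Matrix

noncomputable section

namespace TwoQubit

/-- Operators on `ℂ² ⊗ ℂ²`: the first index is Alice's qubit, the second one Bob's. -/
abbrev Op : Type := Matrix (Fin 2 × Fin 2) (Fin 2 × Fin 2) ℂ

/-- The product vector `φ ⊗ ν`. -/
def prodVec (φ ν : Fin 2 → ℂ) : Fin 2 × Fin 2 → ℂ := fun p => φ p.1 * ν p.2

/-- The value `⟨ψ|R|ψ⟩`. -/
def expect (R : Op) (ψ : Fin 2 × Fin 2 → ℂ) : ℂ := star ψ ⬝ᵥ (R *ᵥ ψ)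

/-- A quantum state: positive semidefinite with unit trace. -/
def IsState (ρ : Op) : Prop := ρ.PosSemidef ∧ ρ.trace = 1

/-- Block positivity: Hermitian, and nonnegative on all product vectors. -/
def IsBlockPositive (R : Op) : Prop :=
  R.IsHermitian ∧ ∀ φ ν : Fin 2 → ℂ, 0 ≤ expect R (prodVec φ ν)

/-- A unit-trace entanglement witness: block positive but not positive semidefinite. -/
def IsEntanglementWitness (W : Op) : Prop :=
  W.trace = 1 ∧ IsBlockPositive W ∧ ¬ W.PosSemidef

/-- The state `ρ` is detected by `W`: `tr (ρ W) < 0` (the trace is real for Hermitian `ρ`, `W`). -/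
def Detects (W ρ : Op) : Prop := IsState ρ ∧ (ρ * W).trace.re < 0

/-- `W₁` is finer than `W₂`: every state detected by `W₂` is detected by `W₁`. -/
def IsFiner (W₁ W₂ : Op) : Prop := ∀ ρ : Op, Detects W₂ ρ → Detects W₁ ρ

/-- An entanglement witness is optimal when no other (unit-trace) entanglement witness is finer. -/
def IsOptimal (W : Op) : Prop :=
  IsEntanglementWitness W ∧
    ¬ ∃ W' : Op, IsEntanglementWitness W' ∧ W' ≠ W ∧ IsFiner W' W

/-- An entanglement witness is weakly optimal when it vanishes on some product state
`φ ⊗ ν` with `φ`, `ν` unit vectors. -/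
def IsWeaklyOptimal (W : Op) : Prop :=
  IsEntanglementWitness W ∧ ∃ φ ν : Fin 2 → ℂ,
    star φ ⬝ᵥ φ = 1 ∧ star ν ⬝ᵥ ν = 1 ∧ expect W (prodVec φ ν) = 0

/-- The Pauli matrices `σ₁, σ₂, σ₃`. -/
def pauli : Fin 3 → Matrix (Fin 2) (Fin 2) ℂ :=
  ![!![0, 1; 1, 0], !![0, -Complex.I; Complex.I, 0], !![1, 0; 0, -1]]

/-- Alice's Bloch vector `a = tr (R σ ⊗ 1)`. -/
def blochA (R : Op) : Fin 3 → ℝ :=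
  fun i => (R * (pauli i ⊗ₖ (1 : Matrix (Fin 2) (Fin 2) ℂ))).trace.re

/-- Bob's Bloch vector `b = tr (R 1 ⊗ σ)`. -/
def blochB (R : Op) : Fin 3 → ℝ :=
  fun j => (R * ((1 : Matrix (Fin 2) (Fin 2) ℂ) ⊗ₖ pauli j)).trace.re

/-- The correlation matrix `T i j = tr (R σ i ⊗ σ j)`. -/
def corr (R : Op) : Matrix (Fin 3) (Fin 3) ℝ :=
  Matrix.of fun i j => (R * (pauli i ⊗ₖ pauli j)).trace.re

/-- `γ_b² = 1 / (1 - |b|²)`. -/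
def gammaSq (R : Op) : ℝ := (1 - blochB R ⬝ᵥ blochB R)⁻¹

/-- The centre `c = γ_b² (a - T b)`; when `|b| = 1` the ellipsoid is the point `a`. -/
def centre (R : Op) : Fin 3 → ℝ :=
  if blochB R ⬝ᵥ blochB R = 1 then blochA R
  else gammaSq R • (blochA R - corr R *ᵥ blochB R)

/-- The ellipsoid matrix `Q = γ_b² (T - a bᵀ) (1 + γ_b² b bᵀ) (Tᵀ - b aᵀ)`; it is zero when
`|b| = 1`, the ellipsoid then being a point. -/
def ellipsoidMatrix (R : Op) : Matrix (Fin 3) (Fin 3) ℝ :=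
  if blochB R ⬝ᵥ blochB R = 1 then 0
  else gammaSq R •
    ((corr R - Matrix.vecMulVec (blochA R) (blochB R)) *
      (1 + gammaSq R • Matrix.vecMulVec (blochB R) (blochB R)) *
      ((corr R)ᵀ - Matrix.vecMulVec (blochB R) (blochA R)))

/-- The solid, possibly degenerate, ellipsoid `{c + √Q u : |u| ≤ 1}`: its centre is `c`, its
semiaxes lie along the eigenvectors of `Q` and have the square roots of the eigenvalues of `Q`
as lengths. Here `√Q` is the positive semidefinite square root. -/
def ellipsoid (R : Op) : Set (EuclideanSpace ℝ (Fin 3)) :=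
  {x | ∃ u : EuclideanSpace ℝ (Fin 3), ‖u‖ ≤ 1 ∧
    x = WithLp.toLp 2 (centre R + cfc Real.sqrt (ellipsoidMatrix R) *ᵥ WithLp.ofLp u)}

/-- Bob's reduced operator `R_B = tr_A R`. -/
def reducedB (R : Op) : Matrix (Fin 2) (Fin 2) ℂ :=
  Matrix.of fun j j' => ∑ i, R (i, j) (i, j')

/-- The filter `1 / √(2 R_B)`, by the functional calculus of Hermitian matrices. -/
def filterB (R : Op) : Matrix (Fin 2) (Fin 2) ℂ :=
  cfc (fun x : ℝ => (Real.sqrt (2 * x))⁻¹) (reducedB R)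

/-- The canonical operator `(1 ⊗ 1/√(2 R_B)) R (1 ⊗ 1/√(2 R_B))`. -/
def canonical (R : Op) : Op :=
  ((1 : Matrix (Fin 2) (Fin 2) ℂ) ⊗ₖ filterB R) * R *
    ((1 : Matrix (Fin 2) (Fin 2) ℂ) ⊗ₖ filterB R)

/-- The chirality `χ = sign (det T̃)`, where `T̃` is the correlation matrix of the canonical
operator; the ellipsoid is right-handed when `χ = 1`. -/
def chirality (R : Op) : SignType := SignType.sign (corr (canonical R)).det

end TwoQubit

end

open scoped ComplexOrder Kronecker Matrix

noncomputable section

namespace TwoQubit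

open Matrix

/-! A witness is optimal exactly when no nonzero positive semidefinite operator can be subtracted
from it without losing block positivity (`isOptimal_iff_isExhausted`). This property, like the
existence of a product zero, survives conjugation by an invertible `A ⊗ B`, so `W` may be replaced
by its canonical form. There Bob's Bloch vector is 0, and with `c` Alice's Bloch vector and `M` the
correlation matrix, four times the value at unit Bloch vectors `x`, `y` is `1 + x·(c + M y)`
(`blochForm_canonical`). Moreover `Q = M Mᵀ`, so the ellipsoid is the image of the unit ball under
`y ↦ c + M y` (`mem_ellipsoid_iff`). Block positivity puts it inside the unit ball, and a zero at
`(x, y)` means that `c + M y = -x` lies on the sphere; this gives (ii).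

For (i), suppose that the ellipsoid is the right-handed unit ball. Then `c = 0`, `M` is a rotation,
and every pair `(-M y, y)` is a zero. A positive `P` that can be subtracted is nonpositive at these
zeros, which sums to `3 tr P ≤ tr (P Σ)` with `Σ = ∑ M i j σ i ⊗ σ j`; since `1 - Σ ≥ 0` for a
rotation, `tr (P Σ) ≤ tr P`, hence `P = 0`.

Conversely, an exhausted operator has a zero, and then a second one whose factors are both
independent of those of the first. A local change of frame moves them to `e₀ ⊗ e₀` and `e₁ ⊗ e₁`,
leaving the four-parameter form `crossOp`. Exhaustion fixes the parameters so that every vector of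
Bob occurs in a zero (`IsExhausted.exists_zero`). So `y ↦ c + M y` maps the sphere into itself,
which forces `c = 0` and `M` orthogonal; `det M = -1` would make the operator positive semidefinite.
-/

/-! ### Bloch vectors and values on product vectors -/

/-- The real number `tr R · x₀ y₀ + y₀ a·x + x₀ b·y + x·T y`. -/
def blochForm (R : Op) (x₀ : ℝ) (x : Fin 3 → ℝ) (y₀ : ℝ) (y : Fin 3 → ℝ) : ℝ :=
  R.trace.re * x₀ * y₀ + y₀ * (blochA R ⬝ᵥ x) + x₀ * (blochB R ⬝ᵥ y) + x ⬝ᵥ (corr R *ᵥ y)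

/-- The squared norm of a vector of `ℂ²`. -/
def nsq (φ : Fin 2 → ℂ) : ℝ := Complex.normSq (φ 0) + Complex.normSq (φ 1)

/-- The (unnormalised) Bloch vector of a vector of `ℂ²`. -/
def bloch (φ : Fin 2 → ℂ) : Fin 3 → ℝ :=
  ![2 * (star (φ 0) * φ 1).re, 2 * (star (φ 0) * φ 1).im,
    Complex.normSq (φ 0) - Complex.normSq (φ 1)]

/-- Evaluate a sum over the index set of two qubits. -/
lemma sum_idx {M : Type*} [AddCommMonoid M] (f : Fin 2 × Fin 2 → M) :
    ∑ p, f p = f (0, 0) + f (0, 1) + (f (1, 0) + f (1, 1)) := by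
  rw [Fintype.sum_prod_type]; simp [Fin.sum_univ_two]

lemma trace_idx (R : Op) :
    R.trace = R (0, 0) (0, 0) + R (0, 1) (0, 1) + (R (1, 0) (1, 0) + R (1, 1) (1, 1)) := by
  simp [Matrix.trace, sum_idx]

lemma blochA_eq (R : Op) : blochA R =
    ![(R (0,0) (1,0) + R (0,1) (1,1) + R (1,0) (0,0) + R (1,1) (0,1)).re,
      (Complex.I * (R (0,0) (1,0) + R (0,1) (1,1) - R (1,0) (0,0) - R (1,1) (0,1))).re,
      (R (0,0) (0,0) + R (0,1) (0,1) - R (1,0) (1,0) - R (1,1) (1,1)).re] := by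
  ext i
  fin_cases i <;>
    simp [blochA, trace_idx, Matrix.mul_apply, sum_idx, pauli, Matrix.kroneckerMap_apply] <;> ring

lemma blochB_eq (R : Op) : blochB R =
    ![(R (0,0) (0,1) + R (0,1) (0,0) + R (1,0) (1,1) + R (1,1) (1,0)).re,
      (Complex.I * (R (0,0) (0,1) - R (0,1) (0,0) + R (1,0) (1,1) - R (1,1) (1,0))).re,
      (R (0,0) (0,0) - R (0,1) (0,1) + R (1,0) (1,0) - R (1,1) (1,1)).re] := by
  ext i
  fin_cases i <;>
    simp [blochB, trace_idx, Matrix.mul_apply, sum_idx, pauli, Matrix.kroneckerMap_apply] <;> ring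

lemma corr_eq (R : Op) : corr R =
    !![(R (0,0) (1,1) + R (0,1) (1,0) + R (1,0) (0,1) + R (1,1) (0,0)).re,
       (Complex.I * (R (0,0) (1,1) - R (0,1) (1,0) + R (1,0) (0,1) - R (1,1) (0,0))).re,
       (R (0,0) (1,0) - R (0,1) (1,1) + R (1,0) (0,0) - R (1,1) (0,1)).re;
       (Complex.I * (R (0,0) (1,1) + R (0,1) (1,0) - R (1,0) (0,1) - R (1,1) (0,0))).re,
       (-R (0,0) (1,1) + R (0,1) (1,0) + R (1,0) (0,1) - R (1,1) (0,0)).re,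
       (Complex.I * (R (0,0) (1,0) - R (0,1) (1,1) - R (1,0) (0,0) + R (1,1) (0,1))).re;
       (R (0,0) (0,1) + R (0,1) (0,0) - R (1,0) (1,1) - R (1,1) (1,0)).re,
       (Complex.I * (R (0,0) (0,1) - R (0,1) (0,0) - R (1,0) (1,1) + R (1,1) (1,0))).re,
       (R (0,0) (0,0) - R (0,1) (0,1) - R (1,0) (1,0) + R (1,1) (1,1)).re] := by
  ext i j
  fin_cases i <;> fin_cases j <;>
    simp [corr, trace_idx, Matrix.mul_apply, sum_idx, pauli, Matrix.kroneckerMap_apply] <;> ring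

/-- The factor 4 is the squared norm of a Pauli product: `R` is a quarter of the sum of its Pauli
coefficients times the Pauli products. -/
lemma expect_re_eq (R : Op) (hR : R.IsHermitian) (φ ν : Fin 2 → ℂ) :
    4 * (expect R (prodVec φ ν)).re = blochForm R (nsq φ) (bloch φ) (nsq ν) (bloch ν) := by
  have h := fun p q => hR.apply p q
  have e : ∀ p q, (R p q).re = (R q p).re ∧ (R p q).im = -(R q p).im := by
    intro p q
    rw [← h p q]; simp
  simp only [expect, prodVec, blochForm, blochA_eq, blochB_eq, corr_eq, trace_idx, dotProduct,
    mulVec, sum_idx, nsq, bloch, Complex.normSq_apply, Fin.sum_univ_three]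
  simp [prodVec]
  simp only [(e (0,1) (0,0)).1, (e (0,1) (0,0)).2, (e (1,0) (0,0)).1, (e (1,0) (0,0)).2,
    (e (1,1) (0,0)).1, (e (1,1) (0,0)).2, (e (1,0) (0,1)).1, (e (1,0) (0,1)).2,
    (e (1,1) (0,1)).1, (e (1,1) (0,1)).2, (e (1,1) (1,0)).1, (e (1,1) (1,0)).2]
  have d : ∀ p, (R p p).im = 0 := fun p => by have := (e p p).2; linarith
  simp only [d]
  ring

lemma expect_im_eq_zero {R : Op} (hR : R.IsHermitian) (ψ : Fin 2 × Fin 2 → ℂ) :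
    (expect R ψ).im = 0 := hR.im_star_dotProduct_mulVec_self ψ

lemma nsq_nonneg (φ : Fin 2 → ℂ) : 0 ≤ nsq φ :=
  add_nonneg (Complex.normSq_nonneg _) (Complex.normSq_nonneg _)

lemma nsq_eq_zero {φ : Fin 2 → ℂ} : nsq φ = 0 ↔ φ = 0 := by
  constructor
  · intro h
    have h0 := Complex.normSq_nonneg (φ 0)
    have h1 := Complex.normSq_nonneg (φ 1)
    unfold nsq at h
    ext i
    fin_cases i
    · exact Complex.normSq_eq_zero.1 (show Complex.normSq (φ 0) = 0 by linarith)
    · exact Complex.normSq_eq_zero.1 (show Complex.normSq (φ 1) = 0 by linarith)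
  · rintro rfl; simp [nsq]

lemma nsq_pos {φ : Fin 2 → ℂ} (h : φ ≠ 0) : 0 < nsq φ :=
  lt_of_le_of_ne (nsq_nonneg φ) fun h' => h (nsq_eq_zero.1 h'.symm)

lemma star_dotProduct_self (φ : Fin 2 → ℂ) : star φ ⬝ᵥ φ = nsq φ := by
  simp [dotProduct, Fin.sum_univ_two, nsq, Complex.normSq_eq_conj_mul_self]

lemma bloch_dotProduct_self (φ : Fin 2 → ℂ) : bloch φ ⬝ᵥ bloch φ = nsq φ ^ 2 := by
  simp [dotProduct, Fin.sum_univ_three, nsq, bloch, Complex.normSq_apply]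
  ring

lemma exists_bloch_eq (x : Fin 3 → ℝ) (hx : x ⬝ᵥ x = 1) :
    ∃ φ : Fin 2 → ℂ, nsq φ = 1 ∧ bloch φ = x := by
  have h3 : x 0 * x 0 + x 1 * x 1 + x 2 * x 2 = 1 := by
    simpa [dotProduct, Fin.sum_univ_three] using hx
  by_cases h : x 2 = -1
  · have h0 : x 0 = 0 := by nlinarith [sq_nonneg (x 0), sq_nonneg (x 1)]
    have h1 : x 1 = 0 := by nlinarith [sq_nonneg (x 0), sq_nonneg (x 1)]
    refine ⟨![0, 1], by simp [nsq], ?_⟩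
    ext i
    fin_cases i <;> simp [bloch, h, h0, h1]
  · have hpos : 0 < 1 + x 2 := by
      have : -1 ≤ x 2 := by nlinarith [sq_nonneg (x 0), sq_nonneg (x 1)]
      rcases this.lt_or_eq with h' | h'
      · linarith
      · exact absurd h'.symm h
    -- Choosing `φ 0` real and positive forces `φ 0 ^ 2 = (1 + x 2) / 2`, so `φ 0 = t / 2`. It would
    -- vanish at the south pole, treated above.
    set t := Real.sqrt (2 * (1 + x 2)) with ht
    have htt : t * t = 2 * (1 + x 2) := Real.mul_self_sqrt (by linarith)
    have htp : 0 < t := Real.sqrt_pos.2 (by linarith)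
    refine ⟨![((t / 2 : ℝ) : ℂ), ⟨x 0 / t, x 1 / t⟩], ?_, ?_⟩
    · simp only [nsq, Complex.normSq_apply]
      simp
      field_simp
      nlinarith
    · ext i
      fin_cases i
      · simp [bloch]; field_simp
      · simp [bloch]; field_simp
      · simp [bloch, Complex.normSq_apply]
        field_simp
        nlinarith

lemma blochForm_smul (R : Op) (s t x₀ y₀ : ℝ) (x y : Fin 3 → ℝ) :
    blochForm R (s * x₀) (s • x) (t * y₀) (t • y) = s * t * blochForm R x₀ x y₀ y := by
  simp only [blochForm, dotProduct_smul, smul_dotProduct, mulVec_smul, smul_eq_mul]; ring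

/-- Block positivity in terms of Bloch vectors. -/
lemma isBlockPositive_iff (R : Op) : IsBlockPositive R ↔ R.IsHermitian ∧
    ∀ x y : Fin 3 → ℝ, x ⬝ᵥ x = 1 → y ⬝ᵥ y = 1 → 0 ≤ blochForm R 1 x 1 y := by
  refine ⟨fun h => ⟨h.1, fun x y hx hy => ?_⟩, fun h => ⟨h.1, fun φ ν => ?_⟩⟩
  · obtain ⟨φ, hφ, rfl⟩ := exists_bloch_eq x hx
    obtain ⟨ν, hν, rfl⟩ := exists_bloch_eq y hy
    have := expect_re_eq R h.1 φ ν
    rw [hφ, hν] at this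
    rw [← this]
    have := (Complex.le_def.1 (h.2 φ ν)).1
    simp at this
    linarith
  · rw [Complex.le_def]
    refine ⟨?_, by rw [expect_im_eq_zero h.1]; rfl⟩
    have e := expect_re_eq R h.1 φ ν
    suffices 0 ≤ blochForm R (nsq φ) (bloch φ) (nsq ν) (bloch ν) by
      simp; linarith
    by_cases hφ : φ = 0
    · subst hφ
      rw [← e]; simp [expect, prodVec, dotProduct]
    by_cases hν : ν = 0
    · subst hν
      rw [← e]; simp [expect, prodVec, dotProduct]
    have p1 := nsq_pos hφ
    have p2 := nsq_pos hν
    have := h.2 ((nsq φ)⁻¹ • bloch φ) ((nsq ν)⁻¹ • bloch ν)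
      (by rw [smul_dotProduct, dotProduct_smul, bloch_dotProduct_self]
          simp; field_simp)
      (by rw [smul_dotProduct, dotProduct_smul, bloch_dotProduct_self]
          simp; field_simp)
    have e2 := blochForm_smul R (nsq φ) (nsq ν) 1 1 ((nsq φ)⁻¹ • bloch φ) ((nsq ν)⁻¹ • bloch ν)
    rw [smul_smul, smul_smul, mul_inv_cancel₀ p1.ne', mul_inv_cancel₀ p2.ne', one_smul, one_smul,
      mul_one, mul_one] at e2
    rw [e2]
    positivity

/-! ### Product zeros, positivity and local conjugation -/

/-- `R` vanishes on some nonzero product vector. -/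
def HasZero (R : Op) : Prop :=
  ∃ φ ν : Fin 2 → ℂ, φ ≠ 0 ∧ ν ≠ 0 ∧ expect R (prodVec φ ν) = 0

lemma expect_eq_zero_iff {R : Op} (hR : R.IsHermitian) (φ ν : Fin 2 → ℂ) :
    expect R (prodVec φ ν) = 0 ↔ blochForm R (nsq φ) (bloch φ) (nsq ν) (bloch ν) = 0 := by
  rw [← expect_re_eq R hR, Complex.ext_iff, expect_im_eq_zero hR]
  simp

lemma expect_eq_zero_iff_unit {R : Op} (hR : R.IsHermitian) {φ ν : Fin 2 → ℂ} (hφ : φ ≠ 0)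
    (hν : ν ≠ 0) : expect R (prodVec φ ν) = 0 ↔
      blochForm R 1 ((nsq φ)⁻¹ • bloch φ) 1 ((nsq ν)⁻¹ • bloch ν) = 0 := by
  have p1 := nsq_pos hφ
  have p2 := nsq_pos hν
  have e2 := blochForm_smul R (nsq φ)⁻¹ (nsq ν)⁻¹ (nsq φ) (nsq ν) (bloch φ) (bloch ν)
  rw [inv_mul_cancel₀ p1.ne', inv_mul_cancel₀ p2.ne'] at e2
  rw [expect_eq_zero_iff hR, e2]
  simp [p1.ne', p2.ne']

lemma unit_smul_bloch {φ : Fin 2 → ℂ} (hφ : φ ≠ 0) :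
    ((nsq φ)⁻¹ • bloch φ) ⬝ᵥ ((nsq φ)⁻¹ • bloch φ) = 1 := by
  have p1 := nsq_pos hφ
  rw [smul_dotProduct, dotProduct_smul, bloch_dotProduct_self]
  simp; field_simp

lemma hasZero_iff {R : Op} (hR : R.IsHermitian) : HasZero R ↔
    ∃ x y : Fin 3 → ℝ, x ⬝ᵥ x = 1 ∧ y ⬝ᵥ y = 1 ∧ blochForm R 1 x 1 y = 0 := by
  constructor
  · rintro ⟨φ, ν, hφ, hν, h⟩
    exact ⟨_, _, unit_smul_bloch hφ, unit_smul_bloch hν, (expect_eq_zero_iff_unit hR hφ hν).1 h⟩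
  · rintro ⟨x, y, hx, hy, h⟩
    obtain ⟨φ, hφ, rfl⟩ := exists_bloch_eq x hx
    obtain ⟨ν, hν, rfl⟩ := exists_bloch_eq y hy
    refine ⟨φ, ν, ?_, ?_, ?_⟩
    · rintro rfl; simp [nsq] at hφ
    · rintro rfl; simp [nsq] at hν
    · rw [expect_eq_zero_iff hR, hφ, hν, h]

lemma isWeaklyOptimal_iff {W : Op} (hW : IsEntanglementWitness W) :
    IsWeaklyOptimal W ↔ HasZero W := by
  have hR := hW.2.1.1
  constructor
  · rintro ⟨-, φ, ν, hφ, hν, h⟩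
    refine ⟨φ, ν, ?_, ?_, h⟩
    · rintro rfl; simp at hφ
    · rintro rfl; simp at hν
  · intro h
    obtain ⟨x, y, hx, hy, h⟩ := (hasZero_iff hR).1 h
    obtain ⟨φ, hφ, rfl⟩ := exists_bloch_eq x hx
    obtain ⟨ν, hν, rfl⟩ := exists_bloch_eq y hy
    refine ⟨hW, φ, ν, ?_, ?_, ?_⟩
    · rw [star_dotProduct_self, hφ]; rfl
    · rw [star_dotProduct_self, hν]; rfl
    · rw [expect_eq_zero_iff hR, hφ, hν, h]

lemma expect_conj (K W : Op) (ψ : Fin 2 × Fin 2 → ℂ) :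
    expect (Kᴴ * W * K) ψ = expect W (K *ᵥ ψ) := by
  simp only [expect, star_mulVec, ← mulVec_mulVec, dotProduct_mulVec, vecMul_vecMul, Matrix.mul_assoc]

lemma expect_add (R S : Op) (ψ : Fin 2 × Fin 2 → ℂ) :
    expect (R + S) ψ = expect R ψ + expect S ψ := by
  simp [expect, add_mulVec, dotProduct_add]

lemma expect_sub (R S : Op) (ψ : Fin 2 × Fin 2 → ℂ) :
    expect (R - S) ψ = expect R ψ - expect S ψ := by
  simp [expect, sub_mulVec, dotProduct_sub]

lemma expect_smul (r : ℝ) (R : Op) (ψ : Fin 2 × Fin 2 → ℂ) :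
    expect (r • R) ψ = r * expect R ψ := by
  simp [expect, smul_mulVec, dotProduct_smul]

lemma expect_eq_trace (R : Op) (ψ : Fin 2 × Fin 2 → ℂ) :
    expect R ψ = (vecMulVec ψ (star ψ) * R).trace := by
  rw [vecMulVec_mul, trace_vecMulVec, expect, dotProduct_mulVec, dotProduct_comm]

lemma kronecker_mulVec_prodVec (A B : Matrix (Fin 2) (Fin 2) ℂ) (φ ν : Fin 2 → ℂ) :
    (A ⊗ₖ B) *ᵥ prodVec φ ν = prodVec (A *ᵥ φ) (B *ᵥ ν) := by
  ext ⟨i, j⟩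
  simp [mulVec, dotProduct, sum_idx, prodVec, kroneckerMap_apply, Fin.sum_univ_two]
  ring

lemma posSemidef_iff_expect {R : Op} : R.PosSemidef ↔ R.IsHermitian ∧ ∀ ψ, 0 ≤ (expect R ψ).re := by
  rw [posSemidef_iff_dotProduct_mulVec]
  refine and_congr_right fun h => forall_congr' fun ψ => ?_
  change 0 ≤ expect R ψ ↔ _
  rw [Complex.le_def, expect_im_eq_zero h]
  simp

lemma isBlockPositive_of_posSemidef {R : Op} (h : R.PosSemidef) : IsBlockPositive R :=
  ⟨h.1, fun _ _ => h.dotProduct_mulVec_nonneg _⟩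

lemma IsBlockPositive.add {R S : Op} (hR : IsBlockPositive R) (hS : IsBlockPositive S) :
    IsBlockPositive (R + S) :=
  ⟨hR.1.add hS.1, fun φ ν => by rw [expect_add]; exact add_nonneg (hR.2 φ ν) (hS.2 φ ν)⟩

lemma isHermitian_real_smul {R : Op} (r : ℝ) (hR : R.IsHermitian) : (r • R).IsHermitian := by
  rw [Matrix.IsHermitian, conjTranspose_smul, hR.eq]; simp

lemma IsBlockPositive.smul {R : Op} {r : ℝ} (hr : 0 ≤ r) (hR : IsBlockPositive R) :
    IsBlockPositive (r • R) :=
  ⟨isHermitian_real_smul r hR.1, fun φ ν => by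
    rw [expect_smul]
    exact mul_nonneg (by exact_mod_cast hr) (hR.2 φ ν)⟩

lemma posSemidef_real_smul {R : Op} {r : ℝ} (hr : 0 ≤ r) (hR : R.PosSemidef) :
    (r • R).PosSemidef := by
  rw [posSemidef_iff_expect] at hR ⊢
  refine ⟨isHermitian_real_smul r hR.1, fun ψ => ?_⟩
  rw [expect_smul, Complex.re_ofReal_mul]
  exact mul_nonneg hr (hR.2 ψ)

lemma IsBlockPositive.conj {R : Op} (A B : Matrix (Fin 2) (Fin 2) ℂ) (hR : IsBlockPositive R) :
    IsBlockPositive ((A ⊗ₖ B)ᴴ * R * (A ⊗ₖ B)) :=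
  ⟨isHermitian_conjTranspose_mul_mul _ hR.1, fun φ ν => by
    rw [expect_conj, kronecker_mulVec_prodVec]; exact hR.2 _ _⟩

lemma trace_mul_nonneg {P S : Op} (hP : P.PosSemidef) (hS : S.PosSemidef) :
    0 ≤ (P * S).trace.re := by
  open scoped MatrixOrder in
  obtain ⟨B, rfl⟩ := CStarAlgebra.nonneg_iff_eq_star_mul_self.1 hS.nonneg
  rw [star_eq_conjTranspose, ← Matrix.mul_assoc, trace_mul_comm, ← Matrix.mul_assoc]
  have := (hP.mul_mul_conjTranspose_same B).trace_nonneg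
  simpa using (Complex.le_def.1 this).1

lemma eq_zero_of_trace_re {P : Op} (hP : P.PosSemidef) (h : P.trace.re ≤ 0) : P = 0 := by
  rw [← hP.trace_eq_zero_iff]
  have := Complex.le_def.1 hP.trace_nonneg
  simp at this
  exact Complex.ext (by simpa using le_antisymm h this.1) this.2.symm

/-! ### Exhausted operators and optimality -/

/-- A block positive operator that is not positive semidefinite and from which no nonzero
positive semidefinite operator can be subtracted without losing block positivity. -/
def IsExhausted (R : Op) : Prop :=
  IsBlockPositive R ∧ ¬ R.PosSemidef ∧ ∀ P : Op, P.PosSemidef → IsBlockPositive (R - P) → P = 0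

lemma conj_kronecker_cancel {A B : Matrix (Fin 2) (Fin 2) ℂ} (hA : A.det ≠ 0) (hB : B.det ≠ 0)
    (R : Op) : (A⁻¹ ⊗ₖ B⁻¹)ᴴ * ((A ⊗ₖ B)ᴴ * R * (A ⊗ₖ B)) * (A⁻¹ ⊗ₖ B⁻¹) = R := by
  have e : (A ⊗ₖ B) * (A⁻¹ ⊗ₖ B⁻¹) = 1 := by
    rw [← mul_kronecker_mul, mul_nonsing_inv _ hA.isUnit, mul_nonsing_inv _ hB.isUnit,
      one_kronecker_one]
  have e' : (A⁻¹ ⊗ₖ B⁻¹)ᴴ * (A ⊗ₖ B)ᴴ = 1 := by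
    rw [← conjTranspose_mul, e, conjTranspose_one]
  calc _ = ((A⁻¹ ⊗ₖ B⁻¹)ᴴ * (A ⊗ₖ B)ᴴ) * R * ((A ⊗ₖ B) * (A⁻¹ ⊗ₖ B⁻¹)) := by
        simp only [Matrix.mul_assoc]
    _ = R := by rw [e, e', Matrix.one_mul, Matrix.mul_one]

lemma posSemidef_of_conj {A B : Matrix (Fin 2) (Fin 2) ℂ} (hA : A.det ≠ 0) (hB : B.det ≠ 0)
    {R : Op} (h : ((A ⊗ₖ B)ᴴ * R * (A ⊗ₖ B)).PosSemidef) : R.PosSemidef := by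
  have := h.conjTranspose_mul_mul_same (A⁻¹ ⊗ₖ B⁻¹)
  rwa [conj_kronecker_cancel hA hB] at this

lemma IsExhausted.conj {R : Op} (h : IsExhausted R) {A B : Matrix (Fin 2) (Fin 2) ℂ}
    (hA : A.det ≠ 0) (hB : B.det ≠ 0) : IsExhausted ((A ⊗ₖ B)ᴴ * R * (A ⊗ₖ B)) := by
  refine ⟨h.1.conj A B, fun h' => h.2.1 (posSemidef_of_conj hA hB h'), fun P hP hRP => ?_⟩
  have h1 := hRP.conj A⁻¹ B⁻¹
  rw [Matrix.mul_sub, Matrix.sub_mul, conj_kronecker_cancel hA hB] at h1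
  have h2 := h.2.2 _ (hP.conjTranspose_mul_mul_same (A⁻¹ ⊗ₖ B⁻¹)) h1
  have hA' : (A⁻¹).det ≠ 0 := by
    exact (isUnit_nonsing_inv_det A hA.isUnit).ne_zero
  have hB' : (B⁻¹).det ≠ 0 := by
    exact (isUnit_nonsing_inv_det B hB.isUnit).ne_zero
  rw [← conj_kronecker_cancel hA' hB' P, h2]
  simp

lemma mulVec_ne_zero {A : Matrix (Fin 2) (Fin 2) ℂ} (hA : A.det ≠ 0) {φ : Fin 2 → ℂ}
    (hφ : φ ≠ 0) : A *ᵥ φ ≠ 0 := fun h => hφ (eq_zero_of_mulVec_eq_zero hA h)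

lemma hasZero_conj_iff {R : Op} {A B : Matrix (Fin 2) (Fin 2) ℂ}
    (hA : A.det ≠ 0) (hB : B.det ≠ 0) : HasZero ((A ⊗ₖ B)ᴴ * R * (A ⊗ₖ B)) ↔ HasZero R := by
  constructor
  · rintro ⟨φ, ν, hφ, hν, h⟩
    rw [expect_conj, kronecker_mulVec_prodVec] at h
    exact ⟨_, _, mulVec_ne_zero hA hφ, mulVec_ne_zero hB hν, h⟩
  · rintro ⟨φ, ν, hφ, hν, h⟩
    have e : ∀ {C : Matrix (Fin 2) (Fin 2) ℂ} (_ : C.det ≠ 0) (v : Fin 2 → ℂ),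
        C *ᵥ (C⁻¹ *ᵥ v) = v := fun hC v => by
      rw [mulVec_mulVec, mul_nonsing_inv _ hC.isUnit, one_mulVec]
    refine ⟨A⁻¹ *ᵥ φ, B⁻¹ *ᵥ ν, ?_, ?_, ?_⟩
    · intro h0; apply hφ; rw [← e hA φ, h0, mulVec_zero]
    · intro h0; apply hν; rw [← e hB ν, h0, mulVec_zero]
    · rw [expect_conj, kronecker_mulVec_prodVec, e hA, e hB, h]

lemma exists_expect_neg {W : Op} (hW : W.IsHermitian) (h : ¬ W.PosSemidef) :
    ∃ ψ, (expect W ψ).re < 0 := by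
  by_contra! h'
  exact h (posSemidef_iff_expect.2 ⟨hW, h'⟩)

lemma trace_mul_neg_of_isFiner {W W' : Op} (h : IsFiner W' W) {ρ : Op} (hρ : ρ.PosSemidef)
    (hn : (ρ * W).trace.re < 0) : (ρ * W').trace.re < 0 := by
  have ht : 0 < ρ.trace.re := by
    by_contra! h0
    rw [eq_zero_of_trace_re hρ h0] at hn
    simp at hn
  have htr : ρ.trace = (ρ.trace.re : ℂ) := by
    have := (Complex.le_def.1 hρ.trace_nonneg).2
    exact Complex.ext rfl (by simpa using this.symm)
  have hs : IsState (ρ.trace.re⁻¹ • ρ) := by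
    refine ⟨posSemidef_real_smul (by positivity) hρ, ?_⟩
    rw [trace_smul, htr]
    simp [ht.ne']
  have := (h _ ⟨hs, by
    rw [smul_mul, trace_smul, Complex.smul_re, smul_eq_mul]
    exact mul_neg_of_pos_of_neg (by positivity) hn⟩).2
  rw [smul_mul, trace_smul, Complex.smul_re, smul_eq_mul] at this
  exact (pos_iff_neg_of_mul_neg this).1 (by positivity)

/-- If `W'` is finer than `W` then `W` is a multiple of `W'` plus a positive operator. -/
lemma exists_posSemidef_sub_of_isFiner {W W' : Op} (hW : IsEntanglementWitness W)
    (hW' : IsEntanglementWitness W') (h : IsFiner W' W) :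
    ∃ r : ℝ, 0 ≤ r ∧ (W - r • W').PosSemidef := by
  set S : Set ℝ := {r | ∃ ρ : Op, ρ.PosSemidef ∧ (ρ * W).trace.re < 0 ∧
    r = (ρ * W).trace.re / (ρ * W').trace.re} with hS
  -- If the inequality failed, the combination of `ρ` and `ρ₁` with weights `tr (ρ₁ W')` and `-tr (ρ
  -- W')` would have zero trace against `W'` while still being detected by `W`. The case `ρ₁ = 1`
  -- bounds `S` by 1, and the supremum of `S` is the required `r`.
  have key : ∀ ρ₁ : Op, ρ₁.PosSemidef → 0 ≤ (ρ₁ * W).trace.re → 0 < (ρ₁ * W').trace.re →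
      ∀ r ∈ S, r ≤ (ρ₁ * W).trace.re / (ρ₁ * W').trace.re := by
    rintro ρ₁ h₁ hw hw' _ ⟨ρ, hρ, hn, rfl⟩
    have hn' := trace_mul_neg_of_isFiner h hρ hn
    by_contra! hlt
    have := trace_mul_neg_of_isFiner h
      ((posSemidef_real_smul hw'.le hρ).add (posSemidef_real_smul (neg_pos.2 hn').le h₁))
      (by
        rw [div_lt_iff₀ hw', div_mul_eq_mul_div, lt_div_iff_of_neg hn'] at hlt
        simp only [Matrix.add_mul, smul_mul, trace_add, trace_smul, Complex.add_re,
          Complex.smul_re, smul_eq_mul]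
        linarith)
    simp only [Matrix.add_mul, smul_mul, trace_add, trace_smul, Complex.add_re,
          Complex.smul_re, smul_eq_mul] at this
    linarith
  have hbdd : BddAbove S := ⟨1, fun r hr => by
    simpa [hW.1, hW'.1] using key 1 PosSemidef.one (by simp [hW.1]) (by simp [hW'.1]) r hr⟩
  obtain ⟨ψ, hψ⟩ := exists_expect_neg hW.2.1.1 hW.2.2
  have hne : S.Nonempty := by
    refine ⟨_, vecMulVec ψ (star ψ), posSemidef_vecMulVec_self_star ψ, ?_, rfl⟩
    rwa [← expect_eq_trace]
  refine ⟨sSup S, Real.sSup_nonneg ?_, posSemidef_iff_expect.2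
    ⟨hW.2.1.1.sub (isHermitian_real_smul _ hW'.2.1.1), fun v => ?_⟩⟩
  · rintro _ ⟨ρ, hρ, hn, rfl⟩
    exact (div_pos_of_neg_of_neg hn (trace_mul_neg_of_isFiner h hρ hn)).le
  have h0 : 0 ≤ sSup S := by
    refine Real.sSup_nonneg ?_
    rintro _ ⟨ρ, hρ, hn, rfl⟩
    exact (div_pos_of_neg_of_neg hn (trace_mul_neg_of_isFiner h hρ hn)).le
  rw [expect_sub, expect_smul, Complex.sub_re, Complex.re_ofReal_mul, expect_eq_trace W,
    expect_eq_trace W', sub_nonneg]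
  have hp := posSemidef_vecMulVec_self_star v
  by_cases hn : (vecMulVec v (star v) * W).trace.re < 0
  · have hn' := trace_mul_neg_of_isFiner h hp hn
    have := le_csSup hbdd ⟨_, hp, hn, rfl⟩
    rwa [div_le_iff_of_neg hn'] at this
  · push Not at hn
    by_cases hw' : 0 < (vecMulVec v (star v) * W').trace.re
    · have := csSup_le hne (key _ hp hn hw')
      rwa [le_div_iff₀ hw'] at this
    · push Not at hw'
      exact (mul_nonpos_of_nonneg_of_nonpos h0 hw').trans hn

lemma expect_single (R : Op) (i j : Fin 2) :
    expect R (prodVec (Pi.single i 1) (Pi.single j 1)) = R (i, j) (i, j) := by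
  have e : prodVec (Pi.single i 1) (Pi.single j 1) = Pi.single (i, j) 1 := by
    ext ⟨k, l⟩
    by_cases h1 : k = i <;> by_cases h2 : l = j <;> simp [prodVec, h1, h2]
  rw [e]
  simp [expect]

lemma IsBlockPositive.diag_nonneg {R : Op} (h : IsBlockPositive R) (p : Fin 2 × Fin 2) :
    0 ≤ (R p p).re ∧ (R p p).im = 0 := by
  have := Complex.le_def.1 (h.2 (Pi.single p.1 1) (Pi.single p.2 1))
  rw [expect_single] at this
  exact ⟨this.1, this.2.symm⟩

lemma IsBlockPositive.trace_nonneg {R : Op} (h : IsBlockPositive R) : 0 ≤ R.trace.re := by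
  rw [trace_idx]
  simp only [Complex.add_re]
  linarith [(h.diag_nonneg (0, 0)).1, (h.diag_nonneg (0, 1)).1, (h.diag_nonneg (1, 0)).1,
    (h.diag_nonneg (1, 1)).1]

/-- A finer `W'` gives `W = r W' + P` with `P ≥ 0`; exhaustion kills `P`, and comparing traces gives
`r = 1`. -/
lemma isOptimal_of_isExhausted {W : Op} (hW : IsEntanglementWitness W) (h : IsExhausted W) :
    IsOptimal W := by
  refine ⟨hW, ?_⟩
  rintro ⟨W', hW', hne, hf⟩
  obtain ⟨r, hr, hP⟩ := exists_posSemidef_sub_of_isFiner hW hW' hf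
  have h0 := h.2.2 _ hP (by rw [sub_sub_cancel]; exact hW'.2.1.smul hr)
  have e := sub_eq_zero.1 h0
  have ht := congrArg Matrix.trace e
  rw [trace_smul, hW.1, hW'.1] at ht
  have hr1 : r = 1 := by
    have := congrArg Complex.re ht
    simpa using this.symm
  rw [hr1, one_smul] at e
  exact hne e.symm

lemma IsOptimal.isExhausted {W : Op} (h : IsOptimal W) : IsExhausted W := by
  obtain ⟨hW, hopt⟩ := h
  refine ⟨hW.2.1, hW.2.2, fun P hP hB => ?_⟩
  by_contra hP0
  apply hopt
  have ht : 0 < P.trace.re := by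
    by_contra! h0
    exact hP0 (eq_zero_of_trace_re hP h0)
  have htr : P.trace = (P.trace.re : ℂ) := by
    have := (Complex.le_def.1 hP.trace_nonneg).2
    exact Complex.ext rfl (by simpa using this.symm)
  set t := P.trace.re with htdef
  have ht1 : t ≤ 1 := by
    have := hB.trace_nonneg
    rw [trace_sub, hW.1, Complex.sub_re, Complex.one_re] at this
    linarith
  have hs : 0 < 1 - t / 2 := by linarith
  -- Only half of `P` is removed: `W - P` could have trace 0, whereas `W - P/2` has trace `1 - t/2 >
  -- 0` and can be renormalised.
  have hBP : IsBlockPositive (W - (1 / 2 : ℝ) • P) := by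
    have : W - (1 / 2 : ℝ) • P = (W - P) + (1 / 2 : ℝ) • P := by module
    rw [this]
    exact hB.add (isBlockPositive_of_posSemidef (posSemidef_real_smul (by norm_num) hP))
  refine ⟨(1 - t / 2)⁻¹ • (W - (1 / 2 : ℝ) • P), ⟨?_, hBP.smul (by positivity), ?_⟩, ?_, ?_⟩
  · rw [trace_smul, trace_sub, trace_smul, htr, hW.1]
    have : ((1 - t / 2 : ℝ) : ℂ) ≠ 0 := by exact_mod_cast hs.ne'
    simp only [Complex.real_smul, Complex.ofReal_inv]
    rw [show (1 : ℂ) - ((1 / 2 : ℝ) : ℂ) * t = ((1 - t / 2 : ℝ) : ℂ) by push_cast; ring]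
    exact inv_mul_cancel₀ this
  · intro hp
    have := (posSemidef_real_smul hs.le hp).add (posSemidef_real_smul (r := 1 / 2) (by norm_num) hP)
    rw [smul_smul, mul_inv_cancel₀ hs.ne', one_smul, sub_add_cancel] at this
    exact hW.2.2 this
  · intro e
    -- If the renormalised operator equalled `W`, then `W` would be a positive multiple of `P`.
    apply hW.2.2
    have e1 : W - (1 / 2 : ℝ) • P = (1 - t / 2) • W := by
      conv_rhs => rw [← e]
      rw [smul_smul, mul_inv_cancel₀ hs.ne', one_smul]
    have e2 : W = t⁻¹ • P := by
      have e3 : t • W = P := by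
        have : (t / 2) • W = (1 / 2 : ℝ) • P := by
          have : (1 / 2 : ℝ) • P = W - (1 - t / 2) • W := by rw [← e1]; abel
          rw [this]; module
        calc t • W = (2 : ℝ) • ((t / 2) • W) := by module
          _ = P := by rw [this]; module
      rw [← e3, smul_smul, inv_mul_cancel₀ ht.ne', one_smul]
    rw [e2]
    exact posSemidef_real_smul (by positivity) hP
  · rintro ρ ⟨hρ, hn⟩
    refine ⟨hρ, ?_⟩
    have := trace_mul_nonneg hρ.1 hP
    rw [Matrix.mul_smul, trace_smul, Complex.smul_re, smul_eq_mul, Matrix.mul_sub, trace_sub,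
      Complex.sub_re, Matrix.mul_smul, trace_smul, Complex.smul_re, smul_eq_mul]
    apply mul_neg_of_pos_of_neg (by positivity)
    linarith

lemma isOptimal_iff_isExhausted {W : Op} (hW : IsEntanglementWitness W) :
    IsOptimal W ↔ IsExhausted W :=
  ⟨IsOptimal.isExhausted, isOptimal_of_isExhausted hW⟩

/-! ### Compressions to one qubit and Bob's reduced operator -/

/-- The operator `⟨φ|R|φ⟩` on Bob's qubit. -/
def compressA (R : Op) (φ : Fin 2 → ℂ) : Matrix (Fin 2) (Fin 2) ℂ :=
  Matrix.of fun j l => ∑ i, ∑ k, star (φ i) * R (i, j) (k, l) * φ k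

/-- The operator `⟨ν|R|ν⟩` on Alice's qubit. -/
def compressB (R : Op) (ν : Fin 2 → ℂ) : Matrix (Fin 2) (Fin 2) ℂ :=
  Matrix.of fun i k => ∑ j, ∑ l, star (ν j) * R (i, j) (k, l) * ν l

lemma expect_compressA (R : Op) (φ ν : Fin 2 → ℂ) :
    star ν ⬝ᵥ (compressA R φ *ᵥ ν) = expect R (prodVec φ ν) := by
  simp [expect, compressA, dotProduct, mulVec, sum_idx, prodVec, Fin.sum_univ_two]
  ring

lemma expect_compressB (R : Op) (φ ν : Fin 2 → ℂ) :
    star φ ⬝ᵥ (compressB R ν *ᵥ φ) = expect R (prodVec φ ν) := by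
  simp [expect, compressB, dotProduct, mulVec, sum_idx, prodVec, Fin.sum_univ_two]
  ring

lemma IsBlockPositive.compressA {R : Op} (h : IsBlockPositive R) (φ : Fin 2 → ℂ) :
    (compressA R φ).PosSemidef := by
  refine PosSemidef.of_dotProduct_mulVec_nonneg ?_ fun ν => ?_
  · ext j l
    simp only [TwoQubit.compressA, conjTranspose_apply, of_apply, Fin.sum_univ_two, star_add, star_mul',
      star_star, h.1.apply]
    ring
  · rw [expect_compressA]; exact h.2 φ ν

lemma IsBlockPositive.compressB {R : Op} (h : IsBlockPositive R) (ν : Fin 2 → ℂ) :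
    (compressB R ν).PosSemidef := by
  refine PosSemidef.of_dotProduct_mulVec_nonneg ?_ fun φ => ?_
  · ext j l
    simp only [TwoQubit.compressB, conjTranspose_apply, of_apply, Fin.sum_univ_two, star_add, star_mul',
      star_star, h.1.apply]
    ring
  · rw [expect_compressB]; exact h.2 φ ν

lemma eq_zero_of_forall_dotProduct_mulVec {N : Matrix (Fin 2) (Fin 2) ℂ}
    (h : ∀ φ : Fin 2 → ℂ, star φ ⬝ᵥ (N *ᵥ φ) = 0) : N = 0 := by
  have h1 := h ![1, 0]
  have h2 := h ![0, 1]
  have h3 := h ![1, 1]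
  have h4 := h ![1, Complex.I]
  simp [dotProduct, mulVec, Fin.sum_univ_two] at h1 h2 h3 h4
  rw [h1, h2] at h3 h4
  have e1 : N 0 1 * Complex.I * 2 = 0 := by linear_combination Complex.I * h3 + h4
  have e2 : N 0 1 = 0 := by simpa using e1
  have e3 : N 1 0 = 0 := by rw [e2] at h3; simpa using h3
  ext i j
  fin_cases i <;> fin_cases j <;> simp [h1, h2, e2, e3]

lemma eq_zero_of_expect_prodVec {D : Op} (h : ∀ φ ν, expect D (prodVec φ ν) = 0) : D = 0 := by
  have hA : ∀ φ, compressA D φ = 0 := fun φ =>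
    eq_zero_of_forall_dotProduct_mulVec fun ν => by rw [expect_compressA, h]
  have hj : ∀ j l i k, D (i, j) (k, l) = 0 := by
    intro j l
    have := eq_zero_of_forall_dotProduct_mulVec (N := Matrix.of fun i k => D (i, j) (k, l))
      fun φ => by
        have := congrFun (congrFun (hA φ) j) l
        simp [compressA, dotProduct, mulVec, Fin.sum_univ_two] at this ⊢
        linear_combination this
    intro i k
    simpa using congrFun (congrFun this i) k
  ext ⟨i, j⟩ ⟨k, l⟩
  exact hj j l i k

/-- A Hermitian operator is determined by its trace, Bloch vectors and correlation matrix. -/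
lemma eq_of_bloch_eq {R S : Op} (hR : R.IsHermitian) (hS : S.IsHermitian)
    (ht : R.trace.re = S.trace.re) (ha : blochA R = blochA S) (hb : blochB R = blochB S)
    (hT : corr R = corr S) : R = S := by
  rw [← sub_eq_zero]
  refine eq_zero_of_expect_prodVec fun φ ν => ?_
  have h1 := expect_re_eq R hR φ ν
  have h2 := expect_re_eq S hS φ ν
  rw [blochForm, ht, ha, hb, hT, ← blochForm, ← h2] at h1
  rw [expect_sub, sub_eq_zero]
  exact Complex.ext (by linarith) (by rw [expect_im_eq_zero hR, expect_im_eq_zero hS])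

/-- Bob's reduced operator of a block positive operator is positive definite unless the operator
is positive semidefinite. -/
lemma reducedB_posDef {R : Op} (h : IsBlockPositive R) (hn : ¬ R.PosSemidef) :
    (reducedB R).PosDef := by
  have e : reducedB R = compressA R ![1, 0] + compressA R ![0, 1] := by
    ext j l
    simp [reducedB, compressA, Fin.sum_univ_two]
  have hp : (reducedB R).PosSemidef := by
    rw [e]; exact (h.compressA _).add (h.compressA _)
  refine PosDef.of_dotProduct_mulVec_pos hp.1 fun {ν} hν => ?_
  refine lt_of_le_of_ne (hp.dotProduct_mulVec_nonneg ν) fun h0 => hn ?_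
  rw [e, add_mulVec, dotProduct_add] at h0
  have n1 := (h.compressA ![1, 0]).dotProduct_mulVec_nonneg ν
  have n2 := (h.compressA ![0, 1]).dotProduct_mulVec_nonneg ν
  have z := (add_eq_zero_iff_of_nonneg n1 n2).1 h0.symm
  rw [expect_compressA, expect_compressA] at z
  have hB := h.compressB ν
  have c0 := (hB.dotProduct_mulVec_zero_iff ![1, 0]).1 (by rw [expect_compressB]; exact z.1)
  have c1 := (hB.dotProduct_mulVec_zero_iff ![0, 1]).1 (by rw [expect_compressB]; exact z.2)
  -- A kernel vector `ν` of the reduced operator makes `e₀ ⊗ ν` and `e₁ ⊗ ν` zeros. Zeros of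
  -- positive semidefinite compressions are kernel vectors, so eventually `R` annihilates every `φ ⊗
  -- ν`.
  have hB0 : compressB R ν = 0 := by
    ext i j
    have d0 := congrFun c0 i
    have d1 := congrFun c1 i
    simp only [mulVec, dotProduct, Fin.sum_univ_two, cons_val_zero, cons_val_one, mul_one, mul_zero,
      add_zero, zero_add, Pi.zero_apply] at d0 d1
    fin_cases j
    · exact d0
    · exact d1
  have hA0 : ∀ φ, compressA R φ *ᵥ ν = 0 := fun φ => by
    rw [← (h.compressA φ).dotProduct_mulVec_zero_iff, expect_compressA, ← expect_compressB, hB0]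
    simp
  have hker : ∀ j i k, R (i, j) (k, 0) * ν 0 + R (i, j) (k, 1) * ν 1 = 0 := by
    intro j
    have := eq_zero_of_forall_dotProduct_mulVec
      (N := Matrix.of fun i k => R (i, j) (k, 0) * ν 0 + R (i, j) (k, 1) * ν 1) fun φ => by
        have := congrFun (hA0 φ) j
        simp [compressA, dotProduct, mulVec, Fin.sum_univ_two] at this ⊢
        linear_combination this
    intro i k
    simpa using congrFun (congrFun this i) k
  have hz : ∀ φ, R *ᵥ prodVec φ ν = 0 := fun φ => by
    ext ⟨i, j⟩
    simp [mulVec, dotProduct, sum_idx, prodVec]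
    linear_combination φ 0 * hker j i 0 + φ 1 * hker j i 1
  refine posSemidef_iff_expect.2 ⟨h.1, fun ψ => ?_⟩
  have hpos : ((nsq ν : ℝ) : ℂ) ≠ 0 := by exact_mod_cast (nsq_pos hν).ne'
  have hnsq : ((nsq ν : ℝ) : ℂ) = star (ν 0) * ν 0 + star (ν 1) * ν 1 := by
    simp [nsq, Complex.normSq_eq_conj_mul_self]
  set φ₁ : Fin 2 → ℂ := fun i => (star (ν 0) * ψ (i, 0) + star (ν 1) * ψ (i, 1)) / nsq ν
  set φ₂ : Fin 2 → ℂ := fun i => (-ν 1 * ψ (i, 0) + ν 0 * ψ (i, 1)) / nsq ν with hφ₂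
  -- Modulo `ℂ² ⊗ ν` every vector is a product with the vector orthogonal to `ν`, so block
  -- positivity already gives full positivity.
  have hψ : ψ = prodVec φ₁ ν + prodVec φ₂ ![-star (ν 1), star (ν 0)] := by
    ext ⟨i, j⟩
    fin_cases j
    · simp [prodVec, φ₁, φ₂]
      field_simp
      rw [hnsq]; simp; ring
    · simp [prodVec, φ₁, φ₂]
      field_simp
      rw [hnsq]; simp; ring
  have : expect R ψ = expect R (prodVec φ₂ ![-star (ν 1), star (ν 0)]) := by
    have hz' : star (prodVec φ₁ ν) ᵥ* R = 0 := by
      rw [← h.1.eq, ← star_mulVec, hz, star_zero]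
    rw [hψ, expect, mulVec_add, hz, zero_add, star_add, add_dotProduct, dotProduct_mulVec, hz',
      zero_dotProduct, zero_add]
    rfl
  rw [this]
  simpa using (Complex.le_def.1 (h.2 _ _)).1

/-! ### The filter and the canonical form -/

lemma filterB_posSemidef (R : Op) : (filterB R).PosSemidef := by
  open scoped MatrixOrder in
  exact (cfc_nonneg fun x _ => by positivity : 0 ≤ filterB R).posSemidef

lemma filterB_mul_self {R : Op} (h : (reducedB R).PosDef) :
    filterB R * filterB R * reducedB R = (1 / 2 : ℝ) • 1 := by
  have hs : IsSelfAdjoint (reducedB R) := h.1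
  have hpos : ∀ x ∈ spectrum ℝ (reducedB R), 0 < x := by
    open scoped MatrixOrder in
    intro x hx
    have h0 : 0 ≤ x := spectrum_nonneg_of_nonneg h.posSemidef.nonneg hx
    refine lt_of_le_of_ne h0 fun h1 => ?_
    rw [← h1] at hx
    exact spectrum.zero_notMem ℝ h.isUnit hx
  have hfin : (spectrum ℝ (reducedB R)).Finite := Matrix.finite_real_spectrum
  have hc : ContinuousOn (fun x : ℝ => (Real.sqrt (2 * x))⁻¹) (spectrum ℝ (reducedB R)) :=
    hfin.continuousOn _
  have hid : ContinuousOn (fun x : ℝ => x) (spectrum ℝ (reducedB R)) := hfin.continuousOn _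
  have e : reducedB R = cfc (fun x : ℝ => x) (reducedB R) := (cfc_id' ℝ _).symm
  calc filterB R * filterB R * reducedB R
      = cfc (fun x : ℝ => (Real.sqrt (2 * x))⁻¹ * (Real.sqrt (2 * x))⁻¹ * x) (reducedB R) := by
        rw [cfc_mul (fun x : ℝ => (Real.sqrt (2 * x))⁻¹ * (Real.sqrt (2 * x))⁻¹) (fun x => x) _
          (hc.mul hc) hid, cfc_mul (fun x : ℝ => (Real.sqrt (2 * x))⁻¹) _ _ hc hc, ← e]
        rfl
    _ = cfc (fun _ : ℝ => (1 / 2 : ℝ)) (reducedB R) := by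
        refine cfc_congr fun x hx => ?_
        have hx' := hpos x hx
        have : Real.sqrt (2 * x) * Real.sqrt (2 * x) = 2 * x := Real.mul_self_sqrt (by linarith)
        change (Real.sqrt (2 * x))⁻¹ * (Real.sqrt (2 * x))⁻¹ * x = 1 / 2
        rw [← mul_inv, this]
        field_simp
    _ = (1 / 2 : ℝ) • 1 := by
        rw [cfc_const _ _ hs, Algebra.algebraMap_eq_smul_one]

/-- The Hermitian matrix `p + f · σ`. -/
def spin (p : ℝ) (f : Fin 3 → ℝ) : Matrix (Fin 2) (Fin 2) ℂ :=
  !![(p : ℂ) + f 2, f 0 - f 1 * Complex.I; f 0 + f 1 * Complex.I, (p : ℂ) - f 2]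

lemma exists_eq_spin {F : Matrix (Fin 2) (Fin 2) ℂ} (h : F.IsHermitian) :
    ∃ p f, F = spin p f := by
  refine ⟨((F 0 0).re + (F 1 1).re) / 2,
    ![(F 1 0).re, (F 1 0).im, ((F 0 0).re - (F 1 1).re) / 2], ?_⟩
  have e : ∀ p q, (F p q).re = (F q p).re ∧ (F p q).im = -(F q p).im := by
    intro p q
    rw [← h.apply p q]; simp
  have d : ∀ p, (F p p).im = 0 := fun p => by have := (e p p).2; linarith
  ext i j
  fin_cases i <;> fin_cases j <;> apply Complex.ext <;> simp [spin, d, (e 0 1).1, (e 0 1).2] <;> ring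

lemma spin_mul_pauli_mul (p : ℝ) (f : Fin 3 → ℝ) (j : Fin 3) :
    spin p f * pauli j * spin p f = ((p ^ 2 - f ⬝ᵥ f : ℝ) : ℂ) • pauli j +
      ((2 * p * f j : ℝ) : ℂ) • (1 : Matrix (Fin 2) (Fin 2) ℂ) +
      ((2 * f j : ℝ) : ℂ) • ((f 0 : ℂ) • pauli 0 + (f 1 : ℂ) • pauli 1 + (f 2 : ℂ) • pauli 2) := by
  fin_cases j <;> ext k l <;> fin_cases k <;> fin_cases l <;> apply Complex.ext <;>
    simp [spin, pauli, Matrix.mul_apply, Fin.sum_univ_two, dotProduct, Fin.sum_univ_three, pow_two] <;> ring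

lemma spin_mul_spin (p : ℝ) (f : Fin 3 → ℝ) :
    spin p f * spin p f = spin (p ^ 2 + f ⬝ᵥ f) ((2 * p) • f) := by
  ext k l
  fin_cases k <;> fin_cases l <;> apply Complex.ext <;>
    simp [spin, Matrix.mul_apply, Fin.sum_univ_two, dotProduct, Fin.sum_univ_three, pow_two] <;> ring

lemma spin_eq (p : ℝ) (f : Fin 3 → ℝ) : spin p f = (p : ℂ) • (1 : Matrix (Fin 2) (Fin 2) ℂ) +
      ((f 0 : ℂ) • pauli 0 + (f 1 : ℂ) • pauli 1 + (f 2 : ℂ) • pauli 2) := by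
  ext k l
  fin_cases k <;> fin_cases l <;> apply Complex.ext <;> simp [spin, pauli, sub_eq_add_neg]

lemma reducedB_eq_spin {R : Op} (hR : R.IsHermitian) :
    reducedB R = spin (R.trace.re / 2) ((1 / 2 : ℝ) • blochB R) := by
  have e : ∀ p q, (R p q).re = (R q p).re ∧ (R p q).im = -(R q p).im := by
    intro p q
    rw [← hR.apply p q]; simp
  have d : ∀ p, (R p p).im = 0 := fun p => by have := (e p p).2; linarith
  ext k l
  fin_cases k <;> fin_cases l <;> apply Complex.ext <;>
    simp [spin, reducedB, trace_idx, blochB_eq, Fin.sum_univ_two, d, (e (0,1) (0,0)).1,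
      (e (0,1) (0,0)).2, (e (1,1) (1,0)).1, (e (1,1) (1,0)).2] <;> ring

lemma spin_mul_eq_one {u : ℝ} {v b : Fin 3 → ℝ} (h : spin u v * spin 1 b = 1) :
    u * (1 - b ⬝ᵥ b) = 1 ∧ v = -u • b := by
  have h00 := congrFun (congrFun h 0) 0
  have h01 := congrFun (congrFun h 0) 1
  have h10 := congrFun (congrFun h 1) 0
  have h11 := congrFun (congrFun h 1) 1
  simp [spin, Matrix.mul_apply, Fin.sum_univ_two, Complex.ext_iff] at h00 h01 h10 h11
  have k0 : v 0 = -u * b 0 := by linear_combination (h01.1 + h10.1) / 2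
  have k1 : v 1 = -u * b 1 := by linear_combination (h10.2 - h01.2) / 2
  have k2 : v 2 = -u * b 2 := by linear_combination (h00.1 - h11.1) / 2
  refine ⟨?_, ?_⟩
  · simp only [dotProduct, Fin.sum_univ_three]
    linear_combination (h00.1 + h11.1) / 2 - b 0 * k0 - b 1 * k1 - b 2 * k2
  · ext i
    fin_cases i
    · simpa using k0
    · simpa using k1
    · simpa using k2

lemma trace_mul_canonical (R : Op) (A B : Matrix (Fin 2) (Fin 2) ℂ) :
    (canonical R * (A ⊗ₖ B)).trace = (R * (A ⊗ₖ (filterB R * B * filterB R))).trace := by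
  have : (1 ⊗ₖ filterB R) * (A ⊗ₖ B) * (1 ⊗ₖ filterB R) = A ⊗ₖ (filterB R * B * filterB R) := by
    simp [← mul_kronecker_mul]
  rw [canonical, ← this, Matrix.mul_assoc, Matrix.mul_assoc, trace_mul_comm]
  simp only [Matrix.mul_assoc]

lemma canonical_eq_conj (R : Op) :
    canonical R = (1 ⊗ₖ filterB R)ᴴ * R * (1 ⊗ₖ filterB R) := by
  rw [conjTranspose_kronecker, (filterB_posSemidef R).1.eq, conjTranspose_one]
  rfl

lemma filterB_det_ne_zero {R : Op} (h : (reducedB R).PosDef) : (filterB R).det ≠ 0 := by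
  intro h0
  have := congrArg det (filterB_mul_self h)
  rw [det_mul, det_mul, h0] at this
  norm_num [det_fin_two, Complex.ext_iff, pow_two] at this

/-- The real parameters of the filter and of the canonical operator. -/
lemma canonical_spec {W : Op} (hW : IsEntanglementWitness W) :
    ∃ u s κ : ℝ, 0 < u ∧ s * s = u ∧ s + κ * (blochB W ⬝ᵥ blochB W) = u ∧
      u * (1 - blochB W ⬝ᵥ blochB W) = 1 ∧ κ * (s + u) = u ^ 2 ∧
      (canonical W).trace = 1 ∧ blochB (canonical W) = 0 ∧
      blochA (canonical W) = u • (blochA W - corr W *ᵥ blochB W) ∧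
      ∀ i j, corr (canonical W) i j =
        s * corr W i j - u * blochA W i * blochB W j
          + κ * (corr W *ᵥ blochB W) i * blochB W j := by
  have hpd := reducedB_posDef hW.2.1 hW.2.2
  have hF := filterB_posSemidef W
  have hFF := filterB_mul_self hpd
  obtain ⟨p, f, hpf⟩ := exists_eq_spin hF.1
  have hred : reducedB W = (1 / 2 : ℝ) • spin 1 (blochB W) := by
    rw [reducedB_eq_spin hW.2.1.1, hW.1]
    ext k l
    fin_cases k <;> fin_cases l <;> apply Complex.ext <;> simp [spin]; ring
  have hone : spin (p ^ 2 + f ⬝ᵥ f) ((2 * p) • f) * spin 1 (blochB W) = 1 := by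
    rw [← spin_mul_spin, ← hpf]
    rw [hred, Matrix.mul_smul] at hFF
    have := congrArg (fun A => (2 : ℝ) • A) hFF
    simpa [smul_smul] using this
  -- With filter `F = p + f·σ`, the square `F² = u + v·σ` inverts `1 + b·σ`. Hence `u = γ²` and `v =
  -- -u b`.
  obtain ⟨hu, hv⟩ := spin_mul_eq_one hone
  have hp0 : 0 ≤ p := by
    have := (Complex.le_def.1 hF.trace_nonneg).1
    rw [hpf] at this
    simp [spin, Matrix.trace, Fin.sum_univ_two] at this
    linarith
  have hs0 : 0 ≤ p ^ 2 - f ⬝ᵥ f := by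
    have := (Complex.le_def.1 hF.det_nonneg).1
    rw [hpf] at this
    simp [spin, det_fin_two] at this
    simp only [dotProduct, Fin.sum_univ_three]
    linarith
  set b := blochB W with hb
  set u := p ^ 2 + f ⬝ᵥ f with hudef
  set s := p ^ 2 - f ⬝ᵥ f with hsdef
  have hff : 0 ≤ f ⬝ᵥ f := by
    simp only [dotProduct, Fin.sum_univ_three]
    nlinarith [sq_nonneg (f 0), sq_nonneg (f 1), sq_nonneg (f 2)]
  have hu0 : 0 < u := by
    have h0 : 0 ≤ u := by positivity
    refine lt_of_le_of_ne h0 fun h => ?_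
    rw [← h] at hu; simp at hu
  have hvj : ∀ j, 2 * p * f j = -u * b j := fun j => by
    have := congrFun hv j
    simpa using this
  have hvv : 4 * p ^ 2 * (f ⬝ᵥ f) = u ^ 2 * (b ⬝ᵥ b) := by
    have h0 := hvj 0
    have h1 := hvj 1
    have h2 := hvj 2
    simp only [dotProduct, Fin.sum_univ_three]
    linear_combination (2 * p * f 0 - u * b 0) * h0 + (2 * p * f 1 - u * b 1) * h1 +
      (2 * p * f 2 - u * b 2) * h2
  -- `s` is `det F`, so `s² = det F² = u² (1 - |b|²) = u`.
  have hss : s * s = u := by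
    have : s * s = u ^ 2 - 4 * p ^ 2 * (f ⬝ᵥ f) := by rw [hsdef, hudef]; ring
    rw [this, hvv]
    linear_combination u * hu
  have hsu : 0 < s + u := by linarith
  -- Follows from `2 p f = -u b` and `2 p² = s + u`; the coefficient is `κ`. The identity `s + κ
  -- |b|² = u` below is what cancels Bob's Bloch vector.
  have hkf : ∀ j k, 2 * f j * f k = u ^ 2 / (s + u) * b j * b k := fun j k => by
    have hp2 : 2 * p ^ 2 = s + u := by rw [hsdef, hudef]; ring
    field_simp
    rw [← hp2]
    linear_combination 2 * p * f k * hvj j - u * b j * hvj k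
  have hκ : s + u ^ 2 / (s + u) * (b ⬝ᵥ b) = u := by
    field_simp
    linear_combination hss - u * hu
  have hlin : ∀ A (x y z : ℂ) (B C D : Matrix (Fin 2) (Fin 2) ℂ),
      (W * (A ⊗ₖ (x • B + y • C + z • D))).trace = x * (W * (A ⊗ₖ B)).trace +
        y * (W * (A ⊗ₖ C)).trace + z * (W * (A ⊗ₖ D)).trace := by
    intro A x y z B C D
    simp [kronecker_add, kronecker_smul, Matrix.mul_add]
  have hFsq : filterB W * filterB W = ((u : ℝ) : ℂ) • (1 : Matrix (Fin 2) (Fin 2) ℂ) +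
      (1 : ℂ) • (((-u * b 0 : ℝ) : ℂ) • pauli 0 + ((-u * b 1 : ℝ) : ℂ) • pauli 1 +
        ((-u * b 2 : ℝ) : ℂ) • pauli 2) + (0 : ℂ) • (0 : Matrix (Fin 2) (Fin 2) ℂ) := by
    rw [hpf, spin_mul_spin, hv, spin_eq]
    simp only [one_smul, zero_smul, add_zero, Pi.smul_apply, smul_eq_mul, hudef]
  have hFj : ∀ j, filterB W * pauli j * filterB W = ((s : ℝ) : ℂ) • pauli j +
      ((-u * b j : ℝ) : ℂ) • (1 : Matrix (Fin 2) (Fin 2) ℂ) +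
      ((2 * f j : ℝ) : ℂ) • ((f 0 : ℂ) • pauli 0 + (f 1 : ℂ) • pauli 1 + (f 2 : ℂ) • pauli 2) := by
    intro j
    rw [hpf, spin_mul_pauli_mul, hvj j]
  have hre : (canonical W).trace.re = 1 := by
    have := trace_mul_canonical W 1 1
    rw [one_kronecker_one, Matrix.mul_one, Matrix.mul_one, hFsq, hlin, hlin, one_kronecker_one,
      Matrix.mul_one, hW.1] at this
    rw [this]
    simp only [dotProduct, Fin.sum_univ_three] at hu
    have hb' : ∀ j, (W * ((1 : Matrix (Fin 2) (Fin 2) ℂ) ⊗ₖ pauli j)).trace.re = b j := fun _ => rfl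
    simp [hb']
    linarith
  have hHerm : (canonical W).IsHermitian := by
    rw [canonical_eq_conj]; exact isHermitian_conjTranspose_mul_mul _ hW.2.1.1
  refine ⟨u, s, u ^ 2 / (s + u), hu0, hss, hκ, hu, by field_simp, ?_, ?_, ?_, ?_⟩
  · refine Complex.ext hre ?_
    have d : ∀ p, (canonical W p p).im = 0 := fun p => by
      have := congrArg Complex.im (hHerm.apply p p)
      simp at this
      linarith
    rw [trace_idx]
    simp [d]
  · ext j
    have : blochB (canonical W) j = s * b j - u * b j + (2 * f j * f 0 * b 0 + 2 * f j * f 1 * b 1 +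
        2 * f j * f 2 * b 2) := by
      have hb' : ∀ j, (W * ((1 : Matrix (Fin 2) (Fin 2) ℂ) ⊗ₖ pauli j)).trace.re = b j :=
        fun _ => rfl
      simp only [blochB]
      rw [trace_mul_canonical, hFj, hlin, hlin, one_kronecker_one, Matrix.mul_one, hW.1]
      simp [hb']
      ring
    rw [this, hkf, hkf, hkf]
    simp only [dotProduct, Fin.sum_univ_three] at hκ
    simp only [Pi.zero_apply]
    linear_combination b j * hκ
  · ext i
    have ha' : ∀ j, (W * (pauli j ⊗ₖ (1 : Matrix (Fin 2) (Fin 2) ℂ))).trace.re = blochA W j :=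
      fun _ => rfl
    have hT' : ∀ i j, (W * (pauli i ⊗ₖ pauli j)).trace.re = corr W i j := fun _ _ => rfl
    simp only [blochA]
    rw [trace_mul_canonical, Matrix.mul_one, hFsq, hlin, hlin]
    simp [ha', hT', mulVec, dotProduct, Fin.sum_univ_three]
    ring
  · intro i j
    have ha' : ∀ j, (W * (pauli j ⊗ₖ (1 : Matrix (Fin 2) (Fin 2) ℂ))).trace.re = blochA W j :=
      fun _ => rfl
    have hT' : ∀ i j, (W * (pauli i ⊗ₖ pauli j)).trace.re = corr W i j := fun _ _ => rfl
    have : corr (canonical W) i j = s * corr W i j - u * b j * blochA W i +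
        (corr W i 0 * (2 * f j * f 0) + corr W i 1 * (2 * f j * f 1) +
          corr W i 2 * (2 * f j * f 2)) := by
      simp only [corr, of_apply]
      rw [trace_mul_canonical, hFj, hlin, hlin]
      simp [ha', hT']
      ring
    rw [this, hkf, hkf, hkf]
    simp only [mulVec, dotProduct, Fin.sum_univ_three]
    ring

lemma blochB_lt_one {W : Op} (hW : IsEntanglementWitness W) : blochB W ⬝ᵥ blochB W < 1 := by
  obtain ⟨u, s, κ, h0, -, -, h, -⟩ := canonical_spec hW
  by_contra! h1
  nlinarith

lemma centre_eq {W : Op} (hW : IsEntanglementWitness W) : centre W = blochA (canonical W) := by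
  obtain ⟨u, s, κ, h0, -, -, h, -, -, -, hA, -⟩ := canonical_spec hW
  have h1 := blochB_lt_one hW
  rw [centre, if_neg h1.ne, hA, gammaSq, eq_inv_of_mul_eq_one_left h]

lemma ellipsoidMatrix_eq {W : Op} (hW : IsEntanglementWitness W) :
    ellipsoidMatrix W = corr (canonical W) * (corr (canonical W))ᵀ := by
  obtain ⟨u, s, κ, h0, hs, hκ, h, hκ2, -, -, -, hM⟩ := canonical_spec hW
  have h1 := blochB_lt_one hW
  have hg : gammaSq W = u := by rw [gammaSq, eq_inv_of_mul_eq_one_left h]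
  rw [ellipsoidMatrix, if_neg h1.ne, hg]
  ext i j
  simp only [Matrix.mul_apply, transpose_apply, hM, Matrix.smul_apply, smul_eq_mul,
    Matrix.sub_apply, vecMulVec_apply, Matrix.add_apply, Matrix.one_apply, mulVec, dotProduct,
    Fin.sum_univ_three] at h hκ ⊢
  simp
  generalize blochB W = b at *
  generalize blochA W = a at *
  generalize corr W = T at *
  -- This is the coefficient of `ti * tj` in `M Mᵀ`. The identities `hs`, `e1`, `hκ` and `h` match
  -- the two sides term by term in `G`, `ti * tj`, the mixed terms and `a i * a j`.
  have e1 : 2 * s * κ + κ ^ 2 * (b 0 * b 0 + b 1 * b 1 + b 2 * b 2) = u ^ 2 := by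
    linear_combination hκ2 + κ * hκ
  set ti := T i 0 * b 0 + T i 1 * b 1 + T i 2 * b 2 with hti
  set tj := T j 0 * b 0 + T j 1 * b 1 + T j 2 * b 2 with htj
  generalize hβd : b 0 * b 0 + b 1 * b 1 + b 2 * b 2 = β at *
  set G := T i 0 * T j 0 + T i 1 * T j 1 + T i 2 * T j 2 with hG
  have lhs : u * (G - ti * a j - a i * tj + β * a i * a j + u * (ti - β * a i) * (tj - β * a j)) =
      s * s * G + s * (ti * (κ * tj - u * a j) + (κ * ti - u * a i) * tj) +
        β * (κ * ti - u * a i) * (κ * tj - u * a j) := by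
    linear_combination -G * hs - ti * tj * e1 + (ti * a j + a i * tj) * (u * hκ + u * h)
      - u * β * a i * a j * h
  have r1 : ∀ k, s * T i k - u * a i * b k + κ * ti * b k = s * T i k + (κ * ti - u * a i) * b k :=
    fun k => by ring
  trans u * (G - ti * a j - a i * tj + β * a i * a j + u * (ti - β * a i) * (tj - β * a j))
  · rw [hti, htj, hG, ← hβd]; ring
  · rw [lhs, hti, htj, hG, ← hβd]; ring

/-! ### The ellipsoid as the image of a ball; touching the sphere -/

lemma dotProduct_sq_le (x y : Fin 3 → ℝ) : (x ⬝ᵥ y) ^ 2 ≤ (x ⬝ᵥ x) * (y ⬝ᵥ y) := by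
  simp only [dotProduct, Fin.sum_univ_three]
  nlinarith [sq_nonneg (x 0 * y 1 - x 1 * y 0), sq_nonneg (x 0 * y 2 - x 2 * y 0),
    sq_nonneg (x 1 * y 2 - x 2 * y 1)]

lemma dotProduct_self_nonneg_real (x : Fin 3 → ℝ) : 0 ≤ x ⬝ᵥ x := by
  simp only [dotProduct, Fin.sum_univ_three]
  nlinarith [sq_nonneg (x 0), sq_nonneg (x 1), sq_nonneg (x 2)]

/-- Every vector is a nonnegative multiple of a unit vector. -/
lemma exists_unit (w : Fin 3 → ℝ) :
    ∃ y : Fin 3 → ℝ, ∃ n : ℝ, y ⬝ᵥ y = 1 ∧ 0 ≤ n ∧ n * n = w ⬝ᵥ w ∧ w = n • y := by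
  have h0 := dotProduct_self_nonneg_real w
  by_cases h : w = 0
  · exact ⟨![1, 0, 0], 0, by simp [dotProduct, Fin.sum_univ_three], le_rfl, by simp [h], by simp [h]⟩
  · have hn : w ⬝ᵥ w ≠ 0 := fun h' => h (dotProduct_self_eq_zero.1 h')
    have hp : 0 < Real.sqrt (w ⬝ᵥ w) := Real.sqrt_pos.2 (lt_of_le_of_ne h0 hn.symm)
    have hs := Real.mul_self_sqrt h0
    refine ⟨(Real.sqrt (w ⬝ᵥ w))⁻¹ • w, Real.sqrt (w ⬝ᵥ w), ?_, hp.le, hs, ?_⟩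
    · rw [smul_dotProduct, dotProduct_smul, smul_eq_mul, smul_eq_mul]
      nth_rewrite 3 [← hs]
      field_simp
    · rw [smul_smul, mul_inv_cancel₀ hp.ne', one_smul]

lemma dotProduct_le_of_sq_le {w y : Fin 3 → ℝ} {α : ℝ} (hα : 0 ≤ α) (hw : w ⬝ᵥ w ≤ α ^ 2)
    (hy : y ⬝ᵥ y ≤ 1) : |w ⬝ᵥ y| ≤ α := by
  refine abs_le_of_sq_le_sq ?_ hα
  have := dotProduct_sq_le w y
  nlinarith [dotProduct_self_nonneg_real w, dotProduct_self_nonneg_real y]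

/-- The minimum over the sphere is `α - |w|`, attained opposite to `w`. -/
lemma affine_nonneg {α : ℝ} {w : Fin 3 → ℝ} (h : ∀ y, y ⬝ᵥ y = 1 → 0 ≤ α + w ⬝ᵥ y) :
    0 ≤ α ∧ w ⬝ᵥ w ≤ α ^ 2 := by
  obtain ⟨y, n, hy, hn, hnn, rfl⟩ := exists_unit w
  have := h (-y) (by simpa using hy)
  rw [dotProduct_neg, smul_dotProduct, hy, smul_eq_mul, mul_one] at this
  refine ⟨by linarith, ?_⟩
  rw [← hnn]
  nlinarith

lemma norm_le_one_iff (u : EuclideanSpace ℝ (Fin 3)) :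
    ‖u‖ ≤ 1 ↔ WithLp.ofLp u ⬝ᵥ WithLp.ofLp u ≤ 1 := by
  rw [EuclideanSpace.norm_eq, Real.sqrt_le_one]
  simp [dotProduct, pow_two]

lemma norm_eq_one_iff (u : EuclideanSpace ℝ (Fin 3)) :
    ‖u‖ = 1 ↔ WithLp.ofLp u ⬝ᵥ WithLp.ofLp u = 1 := by
  rw [EuclideanSpace.norm_eq, Real.sqrt_eq_one]
  simp [dotProduct, pow_two]

/-- The image of the unit ball under `S` has support function `x ↦ |Sᵀ x|`, which depends only on `S
Sᵀ`. Equal support functions give equal compact convex sets, by Hahn–Banach separation. -/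
lemma exists_mulVec_eq {M S : Matrix (Fin 3) (Fin 3) ℝ} (h : M * Mᵀ = S * Sᵀ) {y : Fin 3 → ℝ}
    (hy : y ⬝ᵥ y ≤ 1) : ∃ u : EuclideanSpace ℝ (Fin 3), ‖u‖ ≤ 1 ∧ S *ᵥ WithLp.ofLp u = M *ᵥ y := by
  set L : EuclideanSpace ℝ (Fin 3) →ₗ[ℝ] (Fin 3 → ℝ) :=
    (Matrix.mulVecLin S).comp (WithLp.linearEquiv 2 ℝ (Fin 3 → ℝ)).toLinearMap with hL
  have hLa : ∀ u, L u = S *ᵥ WithLp.ofLp u := fun u => rfl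
  have hK : IsCompact (L '' Metric.closedBall 0 1) :=
    (isCompact_closedBall 0 1).image L.continuous_of_finiteDimensional
  have hC : Convex ℝ (L '' Metric.closedBall 0 1) := (convex_closedBall 0 1).linear_image L
  by_contra! hcon
  have hnot : M *ᵥ y ∉ L '' Metric.closedBall 0 1 := by
    rintro ⟨u, hu, he⟩
    exact hcon u (by simpa using hu) (by rw [← hLa]; exact he)
  obtain ⟨f, s, hs, hs'⟩ := geometric_hahn_banach_closed_point hC hK.isClosed hnot
  obtain ⟨x, hx⟩ : ∃ x : Fin 3 → ℝ, ∀ v, f v = x ⬝ᵥ v := by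
    refine ⟨fun i => f (Pi.single i 1), fun v => ?_⟩
    conv_lhs => rw [pi_eq_sum_univ' v]
    simp [dotProduct, mul_comm, Pi.single]
  have hq : (Sᵀ *ᵥ x) ⬝ᵥ (Sᵀ *ᵥ x) = (Mᵀ *ᵥ x) ⬝ᵥ (Mᵀ *ᵥ x) := by
    have : ∀ N : Matrix (Fin 3) (Fin 3) ℝ, (Nᵀ *ᵥ x) ⬝ᵥ (Nᵀ *ᵥ x) = x ⬝ᵥ ((N * Nᵀ) *ᵥ x) := by
      intro N
      rw [← mulVec_mulVec, dotProduct_mulVec x, ← mulVec_transpose]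
    rw [this, this, h]
  obtain ⟨e, n, he, hn, hnn, hw⟩ := exists_unit (Sᵀ *ᵥ x)
  have h1 := hs (L (WithLp.toLp 2 e)) ⟨_, by
    rw [mem_closedBall_zero_iff, norm_le_one_iff]; exact he.le, rfl⟩
  rw [hLa, hx, dotProduct_mulVec, ← mulVec_transpose, hw, smul_dotProduct, he, smul_eq_mul,
    mul_one] at h1
  rw [hx, dotProduct_mulVec, ← mulVec_transpose] at hs'
  have := dotProduct_le_of_sq_le hn (w := Mᵀ *ᵥ x) (by rw [← hq, ← hnn, pow_two]) hy
  linarith [le_abs_self ((Mᵀ *ᵥ x) ⬝ᵥ y)]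

/-- `√Q` and `M` satisfy `√Q √Qᵀ = Q = M Mᵀ`, so `exists_mulVec_eq` lets `M` replace the square
root. -/
lemma mem_ellipsoid_iff {W : Op} (hW : IsEntanglementWitness W) (x : EuclideanSpace ℝ (Fin 3)) :
    x ∈ ellipsoid W ↔ ∃ y : Fin 3 → ℝ, y ⬝ᵥ y ≤ 1 ∧
      WithLp.ofLp x = blochA (canonical W) + corr (canonical W) *ᵥ y := by
  set M := corr (canonical W) with hM
  have hQ : ellipsoidMatrix W = M * Mᵀ := ellipsoidMatrix_eq hW
  have hpsd : (ellipsoidMatrix W).PosSemidef := by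
    rw [hQ]; exact posSemidef_self_mul_conjTranspose M
  set S := cfc Real.sqrt (ellipsoidMatrix W) with hS
  have hSsym : Sᵀ = S := by
    have : IsSelfAdjoint S := cfc_predicate _ _
    exact this
  have hSS : S * Sᵀ = M * Mᵀ := by
    have hsa : IsSelfAdjoint (ellipsoidMatrix W) := hpsd.1
    have hfin : (spectrum ℝ (ellipsoidMatrix W)).Finite := Matrix.finite_real_spectrum
    rw [hSsym, ← hQ, hS, ← cfc_mul _ _ _ (hfin.continuousOn _) (hfin.continuousOn _)]
    conv_rhs => rw [← cfc_id' ℝ (ellipsoidMatrix W)]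
    refine cfc_congr fun t ht => ?_
    open scoped MatrixOrder in
    exact Real.mul_self_sqrt (spectrum_nonneg_of_nonneg hpsd.nonneg ht)
  rw [ellipsoid, Set.mem_ofPred_eq, centre_eq hW]
  constructor
  · rintro ⟨u, hu, rfl⟩
    obtain ⟨v, hv, he⟩ := exists_mulVec_eq hSS ((norm_le_one_iff u).1 hu)
    exact ⟨WithLp.ofLp v, (norm_le_one_iff v).1 hv, by rw [he]⟩
  · rintro ⟨y, hy, he⟩
    obtain ⟨u, hu, he'⟩ := exists_mulVec_eq hSS.symm hy
    exact ⟨u, hu, by rw [he', ← he]⟩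

lemma canonical_isBlockPositive {W : Op} (hW : IsEntanglementWitness W) :
    IsBlockPositive (canonical W) := by
  rw [canonical_eq_conj]; exact hW.2.1.conj _ _

lemma hasZero_canonical_iff {W : Op} (hW : IsEntanglementWitness W) :
    HasZero (canonical W) ↔ HasZero W := by
  rw [canonical_eq_conj]
  exact hasZero_conj_iff (by simp) (filterB_det_ne_zero (reducedB_posDef hW.2.1 hW.2.2))

lemma isExhausted_canonical_iff {W : Op} (hW : IsEntanglementWitness W) :
    IsExhausted (canonical W) ↔ IsExhausted W := by
  have hF := filterB_det_ne_zero (reducedB_posDef hW.2.1 hW.2.2)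
  have h1 : (1 : Matrix (Fin 2) (Fin 2) ℂ).det ≠ 0 := by simp
  rw [canonical_eq_conj]
  refine ⟨fun h => ?_, fun h => h.conj h1 hF⟩
  have := h.conj (A := 1⁻¹) (B := (filterB W)⁻¹) (by simp)
    (isUnit_nonsing_inv_det _ hF.isUnit).ne_zero
  rwa [conj_kronecker_cancel h1 hF] at this

lemma canonical_not_posSemidef {W : Op} (hW : IsEntanglementWitness W) :
    ¬ (canonical W).PosSemidef := by
  rw [canonical_eq_conj]
  exact fun h => hW.2.2 (posSemidef_of_conj (by simp)
    (filterB_det_ne_zero (reducedB_posDef hW.2.1 hW.2.2)) h)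

/-- The value of the canonical operator on a pair of unit Bloch vectors. -/
lemma blochForm_canonical {W : Op} (hW : IsEntanglementWitness W) (x y : Fin 3 → ℝ) :
    blochForm (canonical W) 1 x 1 y =
      1 + x ⬝ᵥ (blochA (canonical W) + corr (canonical W) *ᵥ y) := by
  obtain ⟨u, s, κ, -, -, -, -, -, ht, hB, -, -⟩ := canonical_spec hW
  rw [blochForm, ht, hB, dotProduct_add, dotProduct_comm x (blochA _)]
  simp
  ring

lemma blochForm_canonical' {W : Op} (hW : IsEntanglementWitness W) (x y : Fin 3 → ℝ) :
    blochForm (canonical W) 1 x 1 y =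
      (1 + x ⬝ᵥ blochA (canonical W)) + ((corr (canonical W))ᵀ *ᵥ x) ⬝ᵥ y := by
  rw [blochForm_canonical hW, dotProduct_add, dotProduct_mulVec, ← mulVec_transpose]
  ring

lemma affine_canonical {W : Op} (hW : IsEntanglementWitness W) {x : Fin 3 → ℝ}
    (hx : x ⬝ᵥ x = 1) : 0 ≤ 1 + x ⬝ᵥ blochA (canonical W) ∧
      ((corr (canonical W))ᵀ *ᵥ x) ⬝ᵥ ((corr (canonical W))ᵀ *ᵥ x) ≤
        (1 + x ⬝ᵥ blochA (canonical W)) ^ 2 :=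
  affine_nonneg fun y hy => by
    rw [← blochForm_canonical' hW]
    exact ((isBlockPositive_iff _).1 (canonical_isBlockPositive hW)).2 x y hx hy

/-- The ellipsoid lies in the unit ball. -/
lemma ellipsoid_point_le_one {W : Op} (hW : IsEntanglementWitness W) {y : Fin 3 → ℝ}
    (hy : y ⬝ᵥ y ≤ 1) :
    (blochA (canonical W) + corr (canonical W) *ᵥ y) ⬝ᵥ
      (blochA (canonical W) + corr (canonical W) *ᵥ y) ≤ 1 := by
  have := (affine_nonneg (α := 1) (w := blochA (canonical W) + corr (canonical W) *ᵥ y)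
    fun x hx => ?_).2
  · simpa using this
  · obtain ⟨h1, h2⟩ := affine_canonical hW hx
    rw [dotProduct_comm, ← blochForm_canonical hW, blochForm_canonical' hW]
    linarith [neg_abs_le (((corr (canonical W))ᵀ *ᵥ x) ⬝ᵥ y), dotProduct_le_of_sq_le h1 h2 hy]

lemma hasZero_iff_ellipsoid {W : Op} (hW : IsEntanglementWitness W) :
    HasZero W ↔ (ellipsoid W ∩ Metric.sphere (0 : EuclideanSpace ℝ (Fin 3)) 1).Nonempty := by
  rw [← hasZero_canonical_iff hW, hasZero_iff (canonical_isBlockPositive hW).1]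
  constructor
  · rintro ⟨x, y, hx, hy, h⟩
    rw [blochForm_canonical hW] at h
    refine ⟨WithLp.toLp 2 (blochA (canonical W) + corr (canonical W) *ᵥ y),
      (mem_ellipsoid_iff hW _).2 ⟨y, hy.le, rfl⟩, ?_⟩
    rw [mem_sphere_zero_iff_norm, norm_eq_one_iff]
    have h1 := ellipsoid_point_le_one hW hy.le
    -- Cauchy–Schwarz: `x·z = -1` with `|x| = 1` forces `|z| ≥ 1`.
    have h2 := dotProduct_sq_le x (blochA (canonical W) + corr (canonical W) *ᵥ y)
    rw [hx, show x ⬝ᵥ (blochA (canonical W) + corr (canonical W) *ᵥ y) = -1 by linarith] at h2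
    refine le_antisymm h1 ?_
    linarith
  · rintro ⟨z, hz, hz1⟩
    obtain ⟨y, hy, he⟩ := (mem_ellipsoid_iff hW _).1 hz
    rw [mem_sphere_zero_iff_norm, norm_eq_one_iff, he] at hz1
    set x := -(blochA (canonical W) + corr (canonical W) *ᵥ y) with hx
    have hx1 : x ⬝ᵥ x = 1 := by rw [hx, neg_dotProduct, dotProduct_neg, neg_neg, hz1]
    have h0 : blochForm (canonical W) 1 x 1 y = 0 := by
      rw [blochForm_canonical hW, hx, neg_dotProduct, hz1]; ring
    rw [blochForm_canonical' hW] at h0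
    obtain ⟨h1, h2⟩ := affine_canonical hW hx1
    -- The point `y` may be interior to the ball when `M` is degenerate. At fixed `x` the form is
    -- affine in `y` and nonnegative on the ball, so its value at the minimiser `-e` on the sphere
    -- is also 0.
    obtain ⟨e, n, he1, hn, hnn, hw⟩ := exists_unit ((corr (canonical W))ᵀ *ᵥ x)
    refine ⟨x, -e, hx1, by simpa using he1, ?_⟩
    rw [blochForm_canonical' hW, hw, dotProduct_neg, smul_dotProduct, he1]
    have h3 := dotProduct_le_of_sq_le hn (w := (corr (canonical W))ᵀ *ᵥ x)
      (by rw [← hnn, pow_two]) hy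
    have h4 := neg_abs_le (((corr (canonical W))ᵀ *ᵥ x) ⬝ᵥ y)
    rw [← hnn, ← pow_two] at h2
    have h5 : n ≤ 1 + x ⬝ᵥ blochA (canonical W) := (abs_le_of_sq_le_sq' h2 h1).2
    simp
    linarith

/-! ### Pauli sums: where chirality meets positivity -/

/-- The operator `∑ M i j σ i ⊗ σ j`. -/
def pauliSum (M : Matrix (Fin 3) (Fin 3) ℝ) : Op :=
  ∑ i, ∑ j, (M i j : ℂ) • (pauli i ⊗ₖ pauli j)

lemma pauli_isHermitian (i : Fin 3) : (pauli i).IsHermitian := by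
  ext k l
  fin_cases i <;> fin_cases k <;> fin_cases l <;> simp [pauli]

lemma pauliSum_isHermitian (M : Matrix (Fin 3) (Fin 3) ℝ) : (pauliSum M).IsHermitian := by
  rw [Matrix.IsHermitian, pauliSum, conjTranspose_sum]
  refine Finset.sum_congr rfl fun i _ => ?_
  rw [conjTranspose_sum]
  refine Finset.sum_congr rfl fun j _ => ?_
  rw [conjTranspose_smul, conjTranspose_kronecker, (pauli_isHermitian i).eq,
    (pauli_isHermitian j).eq]
  simp

lemma pauliSum_apply (M : Matrix (Fin 3) (Fin 3) ℝ) (p q : Fin 2 × Fin 2) : pauliSum M p q =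
    ∑ i, ∑ j, (M i j : ℂ) * (pauli i p.1 q.1 * pauli j p.2 q.2) := by
  simp [pauliSum, Matrix.sum_apply, kroneckerMap_apply]

lemma pauliSum_eq (M : Matrix (Fin 3) (Fin 3) ℝ) (p q : Fin 2 × Fin 2) : pauliSum M p q =
    (!![!![(M 2 2 : ℂ), M 2 0 - M 2 1 * Complex.I; M 2 0 + M 2 1 * Complex.I, -M 2 2],
        !![(M 0 2 : ℂ) - M 1 2 * Complex.I, M 0 0 - M 1 1 - (M 0 1 + M 1 0) * Complex.I;
          M 0 0 + M 1 1 + (M 0 1 - M 1 0) * Complex.I, -M 0 2 + M 1 2 * Complex.I];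
        !![(M 0 2 : ℂ) + M 1 2 * Complex.I, M 0 0 + M 1 1 - (M 0 1 - M 1 0) * Complex.I;
          M 0 0 - M 1 1 + (M 0 1 + M 1 0) * Complex.I, -M 0 2 - M 1 2 * Complex.I],
        !![-(M 2 2 : ℂ), -M 2 0 + M 2 1 * Complex.I; -M 2 0 - M 2 1 * Complex.I, M 2 2]] :
        Matrix (Fin 2) (Fin 2) (Matrix (Fin 2) (Fin 2) ℂ)) p.1 q.1 p.2 q.2 := by
  obtain ⟨i, j⟩ := p
  obtain ⟨k, l⟩ := q
  rw [pauliSum_apply]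
  simp only [Fin.sum_univ_three]
  fin_cases i <;> fin_cases j <;> fin_cases k <;> fin_cases l <;> apply Complex.ext <;>
    simp [pauli] <;> ring

/-- In the product of two Pauli terms, equal indices on both sides contribute `tr (M Mᵀ)`, equal
indices on one side only cancel by anticommutation, and distinct indices on both sides give `i² =
-1` times 2×2 minors. The cofactor matrix is how the sign of `det M` enters. -/
lemma pauliSum_mul_self (M : Matrix (Fin 3) (Fin 3) ℝ) : pauliSum M * pauliSum M =
    ((M * Mᵀ).trace : ℂ) • (1 : Op) - (2 : ℂ) • pauliSum (adjugate M)ᵀ := by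
  ext ⟨i, j⟩ ⟨k, l⟩
  rw [Matrix.mul_apply, sum_idx]
  simp only [Matrix.sub_apply, Matrix.smul_apply, Matrix.one_apply, pauliSum_eq, adjugate_fin_three,
    Matrix.trace, Matrix.diag, Fin.sum_univ_three, Matrix.mul_apply, transpose_apply]
  fin_cases i <;> fin_cases j <;> fin_cases k <;> fin_cases l <;> apply Complex.ext <;>
    simp <;> ring

/-- For a rotation `M` the operator `1 - ∑ M i j σ i ⊗ σ j` is positive. -/
lemma posSemidef_one_sub_pauliSum {M : Matrix (Fin 3) (Fin 3) ℝ} (hM : M * Mᵀ = 1)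
    (hd : M.det = 1) : (1 - pauliSum M).PosSemidef := by
  have hadj : adjugate M = Mᵀ := by
    calc adjugate M = adjugate M * (M * Mᵀ) := by rw [hM, Matrix.mul_one]
      _ = Mᵀ := by rw [← Matrix.mul_assoc, adjugate_mul, hd, one_smul, Matrix.one_mul]
  have hsq := pauliSum_mul_self M
  rw [hadj, transpose_transpose, hM, trace_one] at hsq
  have hH : (1 - pauliSum M).IsHermitian := isHermitian_one.sub (pauliSum_isHermitian M)
  -- For a rotation the cofactor matrix is `M`, so `Σ² = 3 - 2 Σ` and `(1 - Σ)² = 4 (1 - Σ)`.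
  have e : 1 - pauliSum M = (1 / 4 : ℝ) • ((1 - pauliSum M)ᴴ * (1 - pauliSum M)) := by
    rw [hH.eq, Matrix.sub_mul, Matrix.one_mul, Matrix.mul_sub, Matrix.mul_one, hsq]
    simp
    module
  rw [e]
  exact posSemidef_real_smul (by norm_num) (posSemidef_conjTranspose_mul_self _)

lemma trace_mul_pauliSum (P : Op) (M : Matrix (Fin 3) (Fin 3) ℝ) :
    (P * pauliSum M).trace.re = ∑ i, ∑ j, M i j * corr P i j := by
  simp [pauliSum, Matrix.mul_sum, trace_sum, corr]

/-- A Hermitian operator with vanishing Bloch vectors. -/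
lemma eq_smul_one_add_pauliSum {R : Op} (hR : R.IsHermitian) (ha : blochA R = 0)
    (hb : blochB R = 0) : R = (1 / 4 : ℝ) • (R.trace.re • (1 : Op) + pauliSum (corr R)) := by
  refine eq_of_bloch_eq hR ?_ ?_ ?_ ?_ ?_
  · exact isHermitian_real_smul _
      ((isHermitian_real_smul _ isHermitian_one).add (pauliSum_isHermitian _))
  · simp [trace_idx, pauliSum_eq]; ring
  · rw [ha, blochA_eq]; ext i; fin_cases i <;> simp [pauliSum_eq]
  · rw [hb, blochB_eq]; ext i; fin_cases i <;> simp [pauliSum_eq]; ring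
  · generalize corr R = M
    rw [corr_eq]; ext i j
    fin_cases i <;> fin_cases j <;> simp [pauliSum_eq] <;> ring

lemma blochForm_sub (R S : Op) (x₀ y₀ : ℝ) (x y : Fin 3 → ℝ) :
    blochForm (R - S) x₀ x y₀ y = blochForm R x₀ x y₀ y - blochForm S x₀ x y₀ y := by
  have hA : blochA (R - S) = blochA R - blochA S := by ext; simp [blochA, Matrix.sub_mul]
  have hB : blochB (R - S) = blochB R - blochB S := by ext; simp [blochB, Matrix.sub_mul]
  have hT : corr (R - S) = corr R - corr S := by ext; simp [corr, Matrix.sub_mul]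
  simp only [blochForm, hA, hB, hT, trace_sub, Complex.sub_re, sub_dotProduct, sub_mulVec,
    dotProduct_sub]
  ring

/-- A symmetric real matrix whose quadratic form is the squared norm times `t` is scalar. -/
lemma eq_smul_one_of_quadratic {A : Matrix (Fin 3) (Fin 3) ℝ} {t : ℝ} (hA : Aᵀ = A)
    (h : ∀ x, x ⬝ᵥ (A *ᵥ x) = t * (x ⬝ᵥ x)) : A = t • 1 := by
  have hs : ∀ i j, A j i = A i j := fun i j => congrFun (congrFun hA i) j
  have h0 := h ![1, 0, 0]
  have h1 := h ![0, 1, 0]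
  have h2 := h ![0, 0, 1]
  have h01 := h ![1, 1, 0]
  have h02 := h ![1, 0, 1]
  have h12 := h ![0, 1, 1]
  simp [dotProduct, mulVec, Fin.sum_univ_three] at h0 h1 h2 h01 h02 h12
  have s01 := hs 0 1
  have s02 := hs 0 2
  have s12 := hs 1 2
  ext i j
  fin_cases i <;> fin_cases j <;> simp <;> linarith

/-! ### Unit-ball ellipsoids and zeros for every vector of Bob -/

/-- If the ellipsoid is the unit ball, it is centred and its matrix is orthogonal. -/
lemma eq_of_ellipsoid_eq_closedBall {W : Op} (hW : IsEntanglementWitness W)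
    (h : ellipsoid W = Metric.closedBall 0 1) :
    blochA (canonical W) = 0 ∧ corr (canonical W) * (corr (canonical W))ᵀ = 1 := by
  set c := blochA (canonical W)
  set M := corr (canonical W)
  -- The support function `x·c + |Mᵀ x|` of the ellipsoid must equal 1 on unit vectors. Comparing
  -- `x` with `-x` then separates the two terms.
  have key : ∀ x : Fin 3 → ℝ, x ⬝ᵥ x = 1 → ∃ n : ℝ, n * n = (Mᵀ *ᵥ x) ⬝ᵥ (Mᵀ *ᵥ x) ∧ 0 ≤ n ∧
      1 = x ⬝ᵥ c + n := by
    intro x hx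
    obtain ⟨e, n, he, hn, hnn, hw⟩ := exists_unit (Mᵀ *ᵥ x)
    refine ⟨n, hnn, hn, ?_⟩
    have hmem : WithLp.toLp 2 x ∈ ellipsoid W := by
      rw [h, mem_closedBall_zero_iff, norm_le_one_iff]; exact hx.le
    obtain ⟨y, hy, hxy⟩ := (mem_ellipsoid_iff hW _).1 hmem
    have h1 : x ⬝ᵥ (c + M *ᵥ y) = 1 := by rw [← hx]; exact congrArg (x ⬝ᵥ ·) hxy.symm
    rw [dotProduct_add, dotProduct_mulVec, ← mulVec_transpose] at h1
    have h2 := dotProduct_le_of_sq_le hn (w := Mᵀ *ᵥ x) (by rw [← hnn, pow_two]) hy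
    have h3 := ellipsoid_point_le_one hW he.le
    have h4 := dotProduct_sq_le x (c + M *ᵥ e)
    have h5 : x ⬝ᵥ (c + M *ᵥ e) = x ⬝ᵥ c + n := by
      rw [dotProduct_add, dotProduct_mulVec, ← mulVec_transpose, hw, smul_dotProduct, he]; simp
    rw [h5, hx, one_mul] at h4
    have h6 := (abs_le_of_sq_le_sq' (h4.trans (h3.trans (by norm_num : (1 : ℝ) ≤ 1 ^ 2)))
      zero_le_one).2
    have h7 := le_abs_self ((Mᵀ *ᵥ x) ⬝ᵥ y)
    linarith
  have key2 : ∀ x : Fin 3 → ℝ, x ⬝ᵥ x = 1 → x ⬝ᵥ c = 0 ∧ (Mᵀ *ᵥ x) ⬝ᵥ (Mᵀ *ᵥ x) = 1 := by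
    intro x hx
    obtain ⟨n, h1, h2, h3⟩ := key x hx
    obtain ⟨m, h4, h5, h6⟩ := key (-x) (by simpa using hx)
    rw [mulVec_neg, neg_dotProduct, dotProduct_neg, neg_neg, ← h1] at h4
    rw [neg_dotProduct] at h6
    have hmn : m = n := by nlinarith
    have hn1 : n = 1 := by linarith
    refine ⟨by linarith, by rw [← h1, hn1]; norm_num⟩
  have key3 : ∀ x : Fin 3 → ℝ, x ⬝ᵥ ((M * Mᵀ) *ᵥ x) = x ⬝ᵥ x := by
    intro x
    obtain ⟨e, n, he, -, -, rfl⟩ := exists_unit x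
    rw [← mulVec_mulVec, dotProduct_mulVec, ← mulVec_transpose, mulVec_smul, smul_dotProduct,
      dotProduct_smul, (key2 e he).2, smul_dotProduct, dotProduct_smul, he]
  refine ⟨?_, ?_⟩
  · obtain ⟨e, n, he, -, -, hc⟩ := exists_unit c
    have := (key2 e he).1
    rw [hc, dotProduct_smul, he] at this
    rw [hc, show n = 0 by simpa using this, zero_smul]
  · have hsym : (M * Mᵀ)ᵀ = M * Mᵀ := by rw [transpose_mul, transpose_transpose]
    simpa using eq_smul_one_of_quadratic (t := 1) hsym (by simpa using key3)

/-- A witness whose ellipsoid is the right-handed unit ball is exhausted. -/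
lemma isExhausted_of_ellipsoid {W : Op} (hW : IsEntanglementWitness W)
    (h : ellipsoid W = Metric.closedBall 0 1) (hχ : chirality W = 1) : IsExhausted W := by
  rw [← isExhausted_canonical_iff hW]
  obtain ⟨hc, hM⟩ := eq_of_ellipsoid_eq_closedBall hW h
  set M := corr (canonical W) with hMdef
  have hM' : Mᵀ * M = 1 := mul_eq_one_comm.1 hM
  have hdet : M.det = 1 := by
    have h1 : 0 < M.det := sign_eq_one_iff.1 hχ
    have h2 := congrArg det hM
    rw [det_mul, det_transpose, det_one] at h2
    nlinarith
  refine ⟨canonical_isBlockPositive hW, canonical_not_posSemidef hW, fun P hP hB => ?_⟩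
  have hle : ∀ y, y ⬝ᵥ y = 1 → blochForm P 1 (-(M *ᵥ y)) 1 y ≤ 0 := by
    intro y hy
    have hx : (M *ᵥ y) ⬝ᵥ (M *ᵥ y) = 1 := by
      rw [dotProduct_mulVec, ← mulVec_transpose, mulVec_mulVec, hM', one_mulVec, hy]
    have h1 := ((isBlockPositive_iff _).1 hB).2 (-(M *ᵥ y)) y (by simpa using hx) hy
    rw [blochForm_sub, blochForm_canonical hW, hc, zero_add, neg_dotProduct, hx] at h1
    linarith
  -- Adding the inequalities at `y` and `-y` removes both Bloch vectors of `P`. Over the three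
  -- coordinate vectors the right-hand sides add up to `tr (P Σ)`.
  have hsum : ∀ y, y ⬝ᵥ y = 1 → P.trace.re ≤ (M *ᵥ y) ⬝ᵥ (corr P *ᵥ y) := by
    intro y hy
    have h1 := hle y hy
    have h2 := hle (-y) (by simpa using hy)
    simp only [blochForm, mulVec_neg, neg_neg, dotProduct_neg, neg_dotProduct] at h1 h2
    linarith
  have e0 := hsum ![1, 0, 0] (by simp [dotProduct, Fin.sum_univ_three])
  have e1 := hsum ![0, 1, 0] (by simp [dotProduct, Fin.sum_univ_three])
  have e2 := hsum ![0, 0, 1] (by simp [dotProduct, Fin.sum_univ_three])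
  have ht := trace_mul_nonneg hP (posSemidef_one_sub_pauliSum hM hdet)
  rw [Matrix.mul_sub, trace_sub, Complex.sub_re, trace_mul_pauliSum, Matrix.mul_one] at ht
  simp [dotProduct, mulVec, Fin.sum_univ_three] at e0 e1 e2 ht
  exact eq_zero_of_trace_re hP (by linarith)

/-- If every vector of Bob occurs in a zero, the ellipsoid is the right-handed unit ball. -/
lemma ellipsoid_of_forall_zero {W : Op} (hW : IsEntanglementWitness W)
    (h : ∀ ν : Fin 2 → ℂ, ν ≠ 0 → ∃ φ, φ ≠ 0 ∧ expect (canonical W) (prodVec φ ν) = 0) :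
    ellipsoid W = Metric.closedBall 0 1 ∧ chirality W = 1 := by
  have hH := (canonical_isBlockPositive hW).1
  have htr : (canonical W).trace = 1 ∧ blochB (canonical W) = 0 := by
    obtain ⟨u, s, κ, -, -, -, -, -, ht, hB, -, -⟩ := canonical_spec hW
    exact ⟨ht, hB⟩
  have hn := canonical_not_posSemidef hW
  have hmem := fun x => mem_ellipsoid_iff hW x
  have hle := fun y (hy : y ⬝ᵥ y ≤ 1) => ellipsoid_point_le_one hW hy
  have hform := blochForm_canonical hW
  have hχ : chirality W = SignType.sign (corr (canonical W)).det := rfl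
  rw [hχ]
  set V := canonical W
  set c := blochA V with hc
  set M := corr V with hM
  -- A zero gives `x·(c + M y) = -1` with `|x| = 1`, so Cauchy–Schwarz puts this ellipsoid point on
  -- the sphere.
  have hone : ∀ y, y ⬝ᵥ y = 1 → (c + M *ᵥ y) ⬝ᵥ (c + M *ᵥ y) = 1 := by
    intro y hy
    obtain ⟨ν, hν, rfl⟩ := exists_bloch_eq y hy
    have hν0 : ν ≠ 0 := by rintro rfl; simp [nsq] at hν
    obtain ⟨φ, hφ, h0⟩ := h ν hν0
    rw [expect_eq_zero_iff_unit hH hφ hν0, hν, inv_one, one_smul, hform] at h0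
    have h1 := dotProduct_sq_le ((nsq φ)⁻¹ • bloch φ) (c + M *ᵥ bloch ν)
    rw [unit_smul_bloch hφ, show (nsq φ)⁻¹ • bloch φ ⬝ᵥ (c + M *ᵥ bloch ν) = -1 by linarith] at h1
    exact le_antisymm (hle _ hy.le) (by linarith)
  have hboth : ∀ y, y ⬝ᵥ y = 1 → c ⬝ᵥ (M *ᵥ y) = 0 ∧ (M *ᵥ y) ⬝ᵥ (M *ᵥ y) = 1 - c ⬝ᵥ c := by
    intro y hy
    have h1 := hone y hy
    have h2 := hone (-y) (by simpa using hy)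
    simp only [mulVec_neg, dotProduct_add, add_dotProduct, dotProduct_neg, neg_dotProduct,
      dotProduct_comm (M *ᵥ y) c] at h1 h2
    constructor <;> linarith
  have hMM : Mᵀ * M = (1 - c ⬝ᵥ c) • 1 := by
    refine eq_smul_one_of_quadratic (by rw [transpose_mul, transpose_transpose]) fun x => ?_
    obtain ⟨e, n, he, -, -, rfl⟩ := exists_unit x
    rw [← mulVec_mulVec, dotProduct_mulVec, vecMul_transpose, mulVec_smul, smul_dotProduct,
      dotProduct_smul, (hboth e he).2, smul_dotProduct, dotProduct_smul, he]
    simp only [smul_eq_mul]; ring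
  have hMc : Mᵀ *ᵥ c = 0 := by
    obtain ⟨e, n, he, -, -, hw⟩ := exists_unit (Mᵀ *ᵥ c)
    have := (hboth e he).1
    rw [dotProduct_mulVec, ← mulVec_transpose, hw, smul_dotProduct, he] at this
    rw [hw, show n = 0 by simpa using this, zero_smul]
  -- If `|c| = 1` then `M = 0` and the operator is `(1 + c·σ) ⊗ 1 / 4`, which is positive
  -- semidefinite. Otherwise `M` is invertible and `Mᵀ c = 0` forces `c = 0`.
  by_cases ht : 1 - c ⬝ᵥ c = 0
  · exfalso
    apply hn
    have hM0 : M = 0 := by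
      rw [ht, zero_smul] at hMM
      exact conjTranspose_mul_self_eq_zero.1 (by
        rw [conjTranspose_eq_transpose_of_trivial]; exact hMM)
    have hsp : (spin 1 c).PosSemidef := by
      have hsH : (spin 1 c).IsHermitian := by
        ext k l
        fin_cases k <;> fin_cases l <;> apply Complex.ext <;> simp [spin]
      have e : spin 1 c = (1 / 2 : ℝ) • ((spin 1 c)ᴴ * spin 1 c) := by
        rw [hsH.eq, spin_mul_spin, show c ⬝ᵥ c = 1 by linarith]
        ext k l
        fin_cases k <;> fin_cases l <;> apply Complex.ext <;> simp [spin] <;> ring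
      rw [e]
      exact (posSemidef_conjTranspose_mul_self _).smul (by norm_num)
    have hk := hsp.kronecker (PosSemidef.one (n := Fin 2) (R := ℂ))
    have : V = (1 / 4 : ℝ) • (spin 1 c ⊗ₖ (1 : Matrix (Fin 2) (Fin 2) ℂ)) := by
      refine eq_of_bloch_eq hH (isHermitian_real_smul _ hk.1) ?_ ?_ ?_ ?_
      · rw [htr.1]; simp [trace_idx, spin, kroneckerMap_apply]; ring
      · rw [← hc, blochA_eq]; ext i
        fin_cases i <;> simp [spin, kroneckerMap_apply] <;> ring
      · rw [htr.2, blochB_eq]; ext i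
        fin_cases i <;> simp [spin, kroneckerMap_apply] 
      · rw [← hM, hM0, corr_eq]; ext i j
        fin_cases i <;> fin_cases j <;> simp [spin, kroneckerMap_apply]
    rw [this]
    exact posSemidef_real_smul (by norm_num) hk
  · have hinv : ((1 - c ⬝ᵥ c)⁻¹ • Mᵀ) * M = 1 := by
      rw [smul_mul, hMM, smul_smul, inv_mul_cancel₀ ht, one_smul]
    have hinv' := mul_eq_one_comm.1 hinv
    have hc0 : c = 0 := by
      rw [← one_mulVec c, ← hinv', Matrix.mul_smul, smul_mulVec, ← mulVec_mulVec, hMc, mulVec_zero,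
        smul_zero]
    have hMt : Mᵀ * M = 1 := by rw [hMM, hc0]; simp
    have hMMt : M * Mᵀ = 1 := mul_eq_one_comm.1 hMt
    refine ⟨?_, ?_⟩
    · ext x
      rw [hmem, mem_closedBall_zero_iff, norm_le_one_iff, hc0]
      constructor
      · rintro ⟨y, hy, he⟩
        rw [he, zero_add, dotProduct_mulVec, ← mulVec_transpose, mulVec_mulVec, hMt, one_mulVec]
        exact hy
      · intro hx
        refine ⟨Mᵀ *ᵥ x.ofLp, ?_, ?_⟩
        · rwa [dotProduct_mulVec, vecMul_transpose, mulVec_mulVec, hMMt, one_mulVec]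
        · rw [mulVec_mulVec, hMMt, one_mulVec, zero_add]
    · rw [sign_eq_one_iff]
      have h2 := congrArg det hMMt
      rw [det_mul, det_transpose, det_one] at h2
      rcases mul_self_eq_one_iff.1 h2 with h3 | h3
      · rw [h3]; exact one_pos
      · exfalso
        apply hn
        have := eq_smul_one_add_pauliSum hH (by rw [← hc, hc0]) htr.2
        rw [this, htr.1, Complex.one_re, one_smul]
        -- In dimension 3, `det M = -1` makes `-M` a rotation, so the left-handed case is positive
        -- semidefinite.
        have hneg : (1 : Op) + pauliSum M = 1 - pauliSum (-M) := by
          simp [pauliSum]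
        rw [← hM, hneg]
        refine posSemidef_real_smul (by norm_num) (posSemidef_one_sub_pauliSum ?_ ?_)
        · simpa using hMMt
        · rw [det_neg, h3]; norm_num

/-! ### Finding two zeros of an exhausted operator -/

/-- A quadratic polynomial that is bounded below by zero attains its minimum. -/
lemma exists_forall_quadratic_le {E : Type*} [NormedAddCommGroup E] [InnerProductSpace ℝ E]
    [FiniteDimensional ℝ E] (T : E →ₗ[ℝ] E) (hT : T.IsSymmetric) (β : E) (w : ℝ)
    (h : ∀ v, 0 ≤ inner ℝ v (T v) + 2 * inner ℝ β v + w) :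
    ∃ v₀, ∀ v, inner ℝ v₀ (T v₀) + 2 * inner ℝ β v₀ + w ≤
      inner ℝ v (T v) + 2 * inner ℝ β v + w := by
  have hw : 0 ≤ w := by simpa using h 0
  have hline : ∀ v (t : ℝ), 0 ≤ t ^ 2 * inner ℝ v (T v) + 2 * t * inner ℝ β v + w := fun v t => by
    have := h (t • v)
    rw [map_smul, inner_smul_left, inner_smul_right, inner_smul_right] at this
    simp at this
    linarith
  have hpos : ∀ v, 0 ≤ inner ℝ v (T v) := by
    intro v
    by_contra! hneg
    set a := inner ℝ v (T v)
    set b := inner ℝ β v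
    -- At this parameter the negative term `t² a` outweighs `2 t |b| + w`.
    have h1 := hline v ((2 * |b| + w + 1) / (-a) + 1)
    set s := (2 * |b| + w + 1) / (-a) with hs
    have hs0 : 0 ≤ s := div_nonneg (by positivity) (by linarith)
    have hsa : s * (-a) = 2 * |b| + w + 1 := div_mul_cancel₀ _ (by linarith)
    have h2 : b ≤ |b| := le_abs_self b
    nlinarith [mul_nonneg hs0 (abs_nonneg b), mul_nonneg hs0 (sub_nonneg.2 h2)]
  have hker : ∀ k, T k = 0 → inner ℝ β k = 0 := by
    intro k hk
    by_contra hne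
    have h1 := hline k (-(w + 1) / (2 * inner ℝ β k))
    rw [hk, inner_zero_right, mul_zero, zero_add] at h1
    have : 2 * (-(w + 1) / (2 * inner ℝ β k)) * inner ℝ β k = -(w + 1) := by field_simp
    linarith
  -- Orthogonality of `β` to the kernel makes `T v₀ = -β` solvable; the excess over the value at
  -- `v₀` is then `⟨v - v₀, T (v - v₀)⟩ ≥ 0`.
  have hmem : -β ∈ LinearMap.range T := by
    rw [← Submodule.orthogonal_orthogonal (LinearMap.range T), hT.orthogonal_range]
    refine neg_mem (Submodule.mem_orthogonal _ _ |>.2 fun k hk => ?_)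
    rw [real_inner_comm]
    exact hker k hk
  obtain ⟨v₀, hv₀⟩ := hmem
  refine ⟨v₀, fun v => ?_⟩
  have h1 := hpos (v - v₀)
  rw [map_sub, inner_sub_left, inner_sub_right, inner_sub_right, ← hT v₀ v, hv₀, inner_neg_left,
    inner_neg_right, inner_neg_right, real_inner_comm β v, real_inner_comm β v₀] at h1
  rw [hv₀, inner_neg_right, real_inner_comm β v₀]
  linarith

lemma IsBlockPositive.apply_eq_zero {R : Op} (h : IsBlockPositive R) {i j : Fin 2}
    (h0 : R (i, j) (i, j) = 0) (k : Fin 2) :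
    R (i, j) (i, k) = 0 ∧ R (i, k) (i, j) = 0 ∧ R (i, j) (k, j) = 0 ∧ R (k, j) (i, j) = 0 := by
  rw [← expect_single R i j] at h0
  have hA := congrFun (((h.compressA (Pi.single i 1)).dotProduct_mulVec_zero_iff _).1
    (by rw [expect_compressA]; exact h0)) k
  have hB := congrFun (((h.compressB (Pi.single j 1)).dotProduct_mulVec_zero_iff _).1
    (by rw [expect_compressB]; exact h0)) k
  simp [TwoQubit.compressA, TwoQubit.compressB, Pi.single_apply] at hA hB
  exact ⟨by rw [← h.1.apply, hA, star_zero], hA, by rw [← h.1.apply, hB, star_zero], hB⟩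

/-- If the minimum `m` over pairs of unit Bloch vectors were positive, the operator `(m / 4) • 1`,
whose form is constantly `m`, could be subtracted. -/
lemma IsExhausted.hasZero {R : Op} (h : IsExhausted R) : HasZero R := by
  have hH := h.1.1
  have hnn := ((isBlockPositive_iff _).1 h.1).2
  rw [hasZero_iff hH]
  set S : Set (Fin 3 → ℝ) := {x | x ⬝ᵥ x = 1} with hS
  have hSc : IsCompact S := by
    refine Metric.isCompact_of_isClosed_isBounded ?_ ?_
    · exact isClosed_eq (by unfold dotProduct; fun_prop) continuous_const
    · refine (Metric.isBounded_closedBall (x := (0 : Fin 3 → ℝ)) (r := 1)).subset fun x hx => ?_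
      rw [mem_closedBall_zero_iff, pi_norm_le_iff_of_nonneg zero_le_one]
      intro i
      rw [Real.norm_eq_abs, abs_le_one_iff_mul_self_le_one]
      have : x ⬝ᵥ x = 1 := hx
      rw [← this]
      exact Finset.single_le_sum (f := fun i => x i * x i) (fun i _ => mul_self_nonneg _)
        (Finset.mem_univ i)
  have hSn : S.Nonempty := ⟨![1, 0, 0], by simp [hS, dotProduct, Fin.sum_univ_three]⟩
  have hcont : Continuous fun p : (Fin 3 → ℝ) × (Fin 3 → ℝ) => blochForm R 1 p.1 1 p.2 := by
    unfold blochForm mulVec dotProduct; fun_prop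
  obtain ⟨⟨x, y⟩, ⟨hx, hy⟩, hmin⟩ := (hSc.prod hSc).exists_isMinOn (hSn.prod hSn) hcont.continuousOn
  refine ⟨x, y, hx, hy, ?_⟩
  by_contra hne
  set m := blochForm R 1 x 1 y
  have hm : 0 < m := lt_of_le_of_ne (hnn x y hx hy) (Ne.symm hne)
  have hone : ∀ x y, blochForm ((m / 4) • (1 : Op)) 1 x 1 y = m := by
    intro x y
    have hA : blochA ((m / 4) • (1 : Op)) = 0 := by
      rw [blochA_eq]; ext i; fin_cases i <;> simp
    have hB : blochB ((m / 4) • (1 : Op)) = 0 := by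
      rw [blochB_eq]; ext i; fin_cases i <;> simp
    have hT : corr ((m / 4) • (1 : Op)) = 0 := by
      rw [corr_eq]; ext i j; fin_cases i <;> fin_cases j <;> simp
    simp [blochForm, hA, hB, hT]
  have := h.2.2 ((m / 4) • (1 : Op)) (posSemidef_real_smul (by positivity) PosSemidef.one) (by
    refine (isBlockPositive_iff _).2 ⟨hH.sub (isHermitian_real_smul _ isHermitian_one),
      fun x' y' hx' hy' => ?_⟩
    rw [blochForm_sub, hone, sub_nonneg]
    exact hmin (Set.mk_mem_prod hx' hy'))
  have := congrFun (congrFun this (0, 0)) (0, 0)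
  simp at this
  exact hm.ne' this

/-- An exhausted operator vanishing on `e₀ ⊗ e₀` has another zero in general position. -/
lemma IsExhausted.exists_second_zero {R : Op} (h : IsExhausted R)
    (h0 : R (0, 0) (0, 0) = 0) : ∃ X Y : ℂ, expect R (prodVec ![X, 1] ![Y, 1]) = 0 := by
  have hH := h.1.1
  obtain ⟨z1, z2, -, -⟩ := h.1.apply_eq_zero h0 1
  obtain ⟨-, -, z3, z4⟩ := h.1.apply_eq_zero h0 1
  have e : ∀ p q, (R p q).re = (R q p).re ∧ (R p q).im = -(R q p).im := by
    intro p q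
    rw [← hH.apply p q]; simp
  have d : ∀ p, (R p p).im = 0 := fun p => by have := (e p p).2; linarith
  set z := R (0, 0) (1, 1) with hz
  set r := R (0, 1) (1, 0) with hr
  -- The zero at `e₀ ⊗ e₀` kills all terms of degree above 2, so the value at `(X, 1) ⊗ (Y, 1)` is a
  -- real quadratic polynomial in four variables and attains its minimum.
  set A : Matrix (Fin 4) (Fin 4) ℝ :=
    !![(R (0, 1) (0, 1)).re, 0, z.re + r.re, z.im - r.im;
       0, (R (0, 1) (0, 1)).re, z.im + r.im, -z.re + r.re;
       z.re + r.re, z.im + r.im, (R (1, 0) (1, 0)).re, 0;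
       z.im - r.im, -z.re + r.re, 0, (R (1, 0) (1, 0)).re] with hA
  set β : EuclideanSpace ℝ (Fin 4) := WithLp.toLp 2 ![(R (0, 1) (1, 1)).re, (R (0, 1) (1, 1)).im,
    (R (1, 0) (1, 1)).re, (R (1, 0) (1, 1)).im] with hβ
  have hAs : (toEuclideanLin A).IsSymmetric := by
    rw [isSymmetric_toEuclideanLin_iff]
    ext i j
    fin_cases i <;> fin_cases j <;> simp [hA]
  have hval : ∀ X Y : ℂ, (expect R (prodVec ![X, 1] ![Y, 1])).re =
      inner ℝ (WithLp.toLp 2 ![X.re, X.im, Y.re, Y.im])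
        (toEuclideanLin A (WithLp.toLp 2 ![X.re, X.im, Y.re, Y.im])) +
      2 * inner ℝ β (WithLp.toLp 2 ![X.re, X.im, Y.re, Y.im]) + (R (1, 1) (1, 1)).re := by
    intro X Y
    simp only [PiLp.inner_apply, Fin.sum_univ_four, toLpLin_apply, mulVec, dotProduct, hA, hβ,
      expect, sum_idx, prodVec]
    simp [h0, z1, z2, z3, z4, d, (e (1,1) (0,0)).1, (e (1,1) (0,0)).2, (e (1,0) (0,1)).1,
      (e (1,0) (0,1)).2, (e (1,1) (0,1)).1, (e (1,1) (0,1)).2, (e (1,1) (1,0)).1,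
      (e (1,1) (1,0)).2, ← hz, ← hr, prodVec]
    ring
  have hsurj : ∀ v : EuclideanSpace ℝ (Fin 4), ∃ X Y : ℂ,
      v = WithLp.toLp 2 ![X.re, X.im, Y.re, Y.im] := fun v =>
    ⟨⟨v 0, v 1⟩, ⟨v 2, v 3⟩, by ext i; fin_cases i <;> rfl⟩
  have hnn : ∀ φ ν, 0 ≤ (expect R (prodVec φ ν)).re := fun φ ν => by
    simpa using (Complex.le_def.1 (h.1.2 φ ν)).1
  obtain ⟨v₀, hv₀⟩ := exists_forall_quadratic_le _ hAs β (R (1, 1) (1, 1)).re fun v => by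
    obtain ⟨X, Y, rfl⟩ := hsurj v
    rw [← hval]; exact hnn _ _
  obtain ⟨X, Y, rfl⟩ := hsurj v₀
  rw [← hval] at hv₀
  refine ⟨X, Y, ?_⟩
  set m := (expect R (prodVec ![X, 1] ![Y, 1])).re with hm
  by_contra hne
  have hm0 : 0 < m := by
    refine lt_of_le_of_ne (hnn _ _) fun h' => hne (Complex.ext h'.symm ?_)
    rw [expect_im_eq_zero hH]; rfl
  -- If the minimum `m` were positive, `m • E₁` could be subtracted: by homogeneity where `φ 1` and
  -- `ν 1` are nonzero, and trivially elsewhere.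
  set E₁ : Op := vecMulVec (Pi.single (1, 1) 1) (star (Pi.single (1, 1) 1)) with hE
  have hEp : E₁.PosSemidef := posSemidef_vecMulVec_self_star _
  have hEe : ∀ φ ν, (expect E₁ (prodVec φ ν)).re = Complex.normSq (φ 1) * Complex.normSq (ν 1) := by
    intro φ ν
    simp [expect, hE, vecMulVec_apply, mulVec, dotProduct, prodVec, Complex.normSq_apply,
      Pi.single_apply]
    ring
  have := h.2.2 (m • E₁) (posSemidef_real_smul hm0.le hEp) ⟨hH.sub (isHermitian_real_smul _ hEp.1), by
    intro φ ν
    rw [Complex.le_def, expect_im_eq_zero (hH.sub (isHermitian_real_smul _ hEp.1))]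
    refine ⟨?_, rfl⟩
    rw [expect_sub, expect_smul, Complex.sub_re, Complex.re_ofReal_mul, hEe, Complex.zero_re,
      sub_nonneg]
    by_cases hφ : φ 1 = 0
    · simpa [hφ] using hnn φ ν
    by_cases hν : ν 1 = 0
    · simpa [hν] using hnn φ ν
    have hsc : prodVec φ ν = (φ 1 * ν 1) • prodVec ![φ 0 / φ 1, 1] ![ν 0 / ν 1, 1] := by
      ext ⟨i, j⟩
      fin_cases i <;> fin_cases j <;> simp [prodVec] <;> field_simp
    have hsc' : ∀ (c : ℂ) ψ, (expect R (c • ψ)).re = Complex.normSq c * (expect R ψ).re := by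
      intro c ψ
      rw [expect, mulVec_smul, star_smul, smul_dotProduct, dotProduct_smul, smul_smul, smul_eq_mul,
        Complex.star_def, ← Complex.normSq_eq_conj_mul_self, Complex.re_ofReal_mul]
      rfl
    rw [hsc, hsc', map_mul, mul_comm]
    exact mul_le_mul_of_nonneg_left ((hv₀ _).trans_eq (hval _ _).symm)
      (mul_nonneg (Complex.normSq_nonneg _) (Complex.normSq_nonneg _))⟩
  have := congrFun (congrFun this (1, 1)) (1, 1)
  simp [hE, vecMulVec_apply] at this
  exact hm0.ne' this

/-! ### Normal form with zeros at `e₀ ⊗ e₀` and `e₁ ⊗ e₁` -/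

/-- An operator supported on the diagonals of the index square, vanishing on `e₀ ⊗ e₀` and
`e₁ ⊗ e₁`. -/
def crossOp (p q : ℝ) (z r : ℂ) : Op := Matrix.of fun a b =>
  (!![!![(0 : ℂ), 0; 0, p], !![0, z; r, 0]; !![0, star r; star z, 0], !![(q : ℂ), 0; 0, 0]] :
    Matrix (Fin 2) (Fin 2) (Matrix (Fin 2) (Fin 2) ℂ)) a.1 b.1 a.2 b.2

lemma crossOp_isHermitian (p q : ℝ) (z r : ℂ) : (crossOp p q z r).IsHermitian := by
  ext ⟨i, j⟩ ⟨k, l⟩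
  fin_cases i <;> fin_cases j <;> fin_cases k <;> fin_cases l <;> simp [crossOp]

lemma expect_crossOp_re (p q : ℝ) (z r : ℂ) (ψ : Fin 2 × Fin 2 → ℂ) :
    (expect (crossOp p q z r) ψ).re = p * ‖ψ (0, 1)‖ ^ 2 + q * ‖ψ (1, 0)‖ ^ 2 +
      2 * (star (ψ (0, 0)) * z * ψ (1, 1)).re + 2 * (star (ψ (0, 1)) * r * ψ (1, 0)).re := by
  simp only [Complex.sq_norm, Complex.normSq_apply]
  simp [expect, crossOp, mulVec, dotProduct, sum_idx]
  ring

lemma quadratic_nonneg {p q k A B : ℝ} (hp : 0 ≤ p) (hq : 0 ≤ q) (hk : k ^ 2 ≤ p * q)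
    (hA : 0 ≤ A) (hB : 0 ≤ B) : 0 ≤ p * A ^ 2 + q * B ^ 2 - 2 * k * (A * B) := by
  have h1 := Real.mul_self_sqrt hp
  have h2 := Real.mul_self_sqrt hq
  have h3 : k ≤ Real.sqrt p * Real.sqrt q := by
    refine (abs_le_of_sq_le_sq' ?_ (by positivity)).2
    rw [mul_pow, Real.sq_sqrt hp, Real.sq_sqrt hq]; exact hk
  have h4 := mul_le_mul_of_nonneg_right h3 (mul_nonneg hA hB)
  nlinarith [sq_nonneg (Real.sqrt p * A - Real.sqrt q * B)]

lemma crossOp_posSemidef {p q : ℝ} {r : ℂ} (hp : 0 ≤ p) (hq : 0 ≤ q) (hr : ‖r‖ ^ 2 ≤ p * q) :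
    (crossOp p q 0 r).PosSemidef := by
  refine posSemidef_iff_expect.2 ⟨crossOp_isHermitian _ _ _ _, fun ψ => ?_⟩
  rw [expect_crossOp_re]
  have h1 := quadratic_nonneg hp hq hr (norm_nonneg (ψ (0, 1))) (norm_nonneg (ψ (1, 0)))
  have h2 := neg_le_of_abs_le (Complex.abs_re_le_norm (star (ψ (0, 1)) * r * ψ (1, 0)))
  rw [norm_mul, norm_mul, norm_star] at h2
  simp
  simp at h2
  nlinarith

/-- On product vectors `|ψ₀₀ ψ₁₁| = |ψ₀₁ ψ₁₀|`, so `z` is controlled by `p q` just as `r` is for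
positivity. -/
lemma crossOp_isBlockPositive {p q : ℝ} {z : ℂ} (hp : 0 ≤ p) (hq : 0 ≤ q)
    (hz : ‖z‖ ^ 2 ≤ p * q) : IsBlockPositive (crossOp p q z 0) := by
  refine ⟨crossOp_isHermitian _ _ _ _, fun φ ν => ?_⟩
  rw [Complex.le_def, expect_im_eq_zero (crossOp_isHermitian _ _ _ _), expect_crossOp_re]
  refine ⟨?_, rfl⟩
  have h1 := quadratic_nonneg hp hq hz (norm_nonneg (prodVec φ ν (0, 1)))
    (norm_nonneg (prodVec φ ν (1, 0)))
  have h2 := neg_le_of_abs_le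
    (Complex.abs_re_le_norm (star (prodVec φ ν (0, 0)) * z * prodVec φ ν (1, 1)))
  simp [prodVec] at h1 h2 ⊢
  nlinarith

/-- Two free local phases suffice to make both coupling terms as negative as possible at once, so
`|z|` and `|r|` add up. -/
lemma exists_phases (z r : ℂ) : ∃ α β : ℂ, ‖α‖ = 1 ∧ ‖β‖ = 1 ∧ z * (α * β) = -‖z‖ ∧
    r * (α * star β) = -‖r‖ := by
  have hz := Complex.norm_mul_exp_arg_mul_I z
  have hr := Complex.norm_mul_exp_arg_mul_I r
  refine ⟨Complex.exp (((Real.pi - (z.arg + r.arg) / 2 : ℝ) : ℂ) * Complex.I),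
    Complex.exp ((((r.arg - z.arg) / 2 : ℝ) : ℂ) * Complex.I),
    Complex.norm_exp_ofReal_mul_I _, Complex.norm_exp_ofReal_mul_I _, ?_, ?_⟩
  · rw [← Complex.exp_add]
    refine (congrArg (· * _) hz).symm.trans ?_
    rw [mul_assoc, ← Complex.exp_add]
    have : (z.arg : ℂ) * Complex.I + (((Real.pi - (z.arg + r.arg) / 2 : ℝ) : ℂ) * Complex.I +
      (((r.arg - z.arg) / 2 : ℝ) : ℂ) * Complex.I) = Real.pi * Complex.I := by push_cast; ring
    rw [this, Complex.exp_pi_mul_I]; ring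
  · rw [Complex.star_def, ← Complex.exp_conj, map_mul, Complex.conj_ofReal, Complex.conj_I,
      ← Complex.exp_add]
    refine (congrArg (· * _) hr).symm.trans ?_
    rw [mul_assoc, ← Complex.exp_add]
    have : (r.arg : ℂ) * Complex.I + (((Real.pi - (z.arg + r.arg) / 2 : ℝ) : ℂ) * Complex.I +
      (((r.arg - z.arg) / 2 : ℝ) : ℂ) * -Complex.I) = Real.pi * Complex.I := by push_cast; ring
    rw [this, Complex.exp_pi_mul_I]; ring

lemma sq_le_of_crossOp_isBlockPositive {p q : ℝ} {z r : ℂ}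
    (h : IsBlockPositive (crossOp p q z r)) :
    0 ≤ p ∧ 0 ≤ q ∧ (‖z‖ + ‖r‖) ^ 2 ≤ p * q := by
  obtain ⟨α, β, hα, hβ, hz, hr⟩ := exists_phases z r
  have key : ∀ s t : ℝ, 0 ≤ p * s ^ 2 + q * t ^ 2 - 2 * (s * t) * (‖z‖ + ‖r‖) := by
    intro s t
    have h1 := (Complex.le_def.1 (h.2 ![1, t * α] ![1, s * β])).1
    rw [expect_crossOp_re] at h1
    have e1 : star (prodVec ![1, t * α] ![1, s * β] (0, 0)) * z *
        prodVec ![1, t * α] ![1, s * β] (1, 1) = ((-(s * t * ‖z‖) : ℝ) : ℂ) := by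
      simp [prodVec]
      linear_combination s * t * hz
    have e2 : star (prodVec ![1, t * α] ![1, s * β] (0, 1)) * r *
        prodVec ![1, t * α] ![1, s * β] (1, 0) = ((-(s * t * ‖r‖) : ℝ) : ℂ) := by
      simp [prodVec] at hr ⊢
      linear_combination s * t * hr
    rw [e1, e2, Complex.ofReal_re, Complex.ofReal_re] at h1
    simp [prodVec, hα, hβ] at h1
    linarith
  have hp : 0 ≤ p := by simpa using key 1 0
  have hq : 0 ≤ q := by simpa using key 0 1
  refine ⟨hp, hq, ?_⟩
  have hK : 0 ≤ ‖z‖ + ‖r‖ := by positivity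
  set K := ‖z‖ + ‖r‖
  rcases hp.eq_or_lt with hp0 | hp0
  · rcases hK.eq_or_lt with hK0 | hK0
    · rw [← hK0, ← hp0]; norm_num
    · have := key ((q + 1) / (2 * K)) 1
      rw [← hp0] at this
      have e : 2 * ((q + 1) / (2 * K) * 1) * K = q + 1 := by field_simp
      rw [e] at this
      linarith
  · have := key K p
    have e : p * K ^ 2 + q * p ^ 2 - 2 * (K * p) * K = p * (p * q - K ^ 2) := by ring
    rw [e] at this
    have := nonneg_of_mul_nonneg_right this hp0
    linarith

/-- When `|z|² = p q` the compression by `ν` is singular on Alice's side; the witness lies in its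
kernel. -/
lemma crossOp_zeros {p q : ℝ} {z : ℂ} (hp : 0 < p) (hz : z ≠ 0) (hzpq : ‖z‖ ^ 2 = p * q)
    {ν : Fin 2 → ℂ} (hν : ν ≠ 0) : ∃ φ, φ ≠ 0 ∧ expect (crossOp p q z 0) (prodVec φ ν) = 0 := by
  refine ⟨![-z * star (ν 0), p * star (ν 1)], fun h0 => hν ?_, ?_⟩
  · have h1 := congrFun h0 0
    have h2 := congrFun h0 1
    simp [hz, hp.ne'] at h1 h2
    ext i; fin_cases i
    · exact h1
    · exact h2
  · refine Complex.ext ?_ (expect_im_eq_zero (crossOp_isHermitian _ _ _ _) _)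
    rw [expect_crossOp_re]
    have e : star (prodVec ![-z * star (ν 0), p * star (ν 1)] ν (0, 0)) * z *
        prodVec ![-z * star (ν 0), p * star (ν 1)] ν (1, 1) =
        ((-(p * ‖z‖ ^ 2 * ‖ν 0‖ ^ 2 * ‖ν 1‖ ^ 2) : ℝ) : ℂ) := by
      push_cast
      rw [← Complex.conj_mul' z, ← Complex.conj_mul' (ν 0), ← Complex.conj_mul' (ν 1)]
      simp [prodVec]
      ring
    rw [e, Complex.ofReal_re]
    simp [prodVec, mul_pow, abs_of_pos hp]
    linear_combination (-p * ‖ν 0‖ ^ 2 * ‖ν 1‖ ^ 2) * hzpq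

/-- In an exhausted operator of this form every vector of Bob occurs in a zero. -/
lemma exists_zero_of_crossOp {p q : ℝ} {z r : ℂ} (h : IsExhausted (crossOp p q z r))
    {ν : Fin 2 → ℂ} (hν : ν ≠ 0) : ∃ φ, φ ≠ 0 ∧ expect (crossOp p q z r) (prodVec φ ν) = 0 := by
  obtain ⟨hp, hq, hK⟩ := sq_le_of_crossOp_isBlockPositive h.1
  have hz0 := norm_nonneg z
  have hr0 := norm_nonneg r
  have hz : z ≠ 0 := by
    rintro rfl
    exact h.2.1 (crossOp_posSemidef hp hq (by simpa using hK))
  have hzp : 0 < ‖z‖ := norm_pos_iff.2 hz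
  have hpq : 0 < p * q := lt_of_lt_of_le (by positivity) hK
  have hp' : 0 < p := lt_of_le_of_ne hp (by rintro rfl; simp at hpq)
  set m := Real.sqrt (p * q) with hm
  have hmm : m * m = p * q := Real.mul_self_sqrt hpq.le
  have hm0 : 0 < m := Real.sqrt_pos.2 hpq
  have hKm : ‖z‖ + ‖r‖ ≤ m := (abs_le_of_sq_le_sq' (by rw [pow_two m, hmm]; exact hK) hm0.le).2
  -- The operator splits into a part with weights `l p`, `l q` carrying `r` and a part with weights
  -- `(1 - l) p`, `(1 - l) q` carrying `z`. This `l` leaves just enough weight for `z`, and `‖r‖ ≤ m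
  -- - ‖z‖ = l m` makes the first part positive semidefinite. Exhaustion kills it, giving `r = 0`
  -- and `‖z‖ = m`.
  set l := 1 - ‖z‖ / m with hl
  have hlm : l * m = m - ‖z‖ := by rw [hl]; field_simp
  have hl0 : 0 ≤ l := nonneg_of_mul_nonneg_left (by rw [hlm]; linarith) hm0
  have hl1 : 0 ≤ 1 - l := by rw [hl]; simp; positivity
  have hsub : crossOp p q z r - crossOp (l * p) (l * q) 0 r =
      crossOp ((1 - l) * p) ((1 - l) * q) z 0 := by
    ext ⟨i, j⟩ ⟨k, n⟩
    fin_cases i <;> fin_cases j <;> fin_cases k <;> fin_cases n <;> simp [crossOp] <;> ring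
  have h0 := h.2.2 (crossOp (l * p) (l * q) 0 r)
    (crossOp_posSemidef (by positivity) (by positivity) (by
      have : l * p * (l * q) = (l * m) ^ 2 := by linear_combination -l ^ 2 * hmm
      rw [this, hlm]
      exact pow_le_pow_left₀ hr0 (by linarith) 2))
    (by
      rw [hsub]
      refine crossOp_isBlockPositive (by positivity) (by positivity) (le_of_eq ?_)
      have : (1 - l) * p * ((1 - l) * q) = (m - l * m) ^ 2 := by
        linear_combination -(1 - l) ^ 2 * hmm
      rw [this, hlm]; ring)
  have hr : r = 0 := by simpa [crossOp] using congrFun (congrFun h0 (0, 1)) (1, 0)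
  have hlz : l = 0 := by simpa [crossOp, hp'.ne'] using congrFun (congrFun h0 (0, 1)) (0, 1)
  rw [hr]
  refine crossOp_zeros hp' hz ?_ hν
  rw [hlz] at hlm
  have : ‖z‖ = m := by linarith
  rw [this, pow_two, hmm]

lemma eq_crossOp {R : Op} (h : IsBlockPositive R) (h0 : R (0, 0) (0, 0) = 0)
    (h1 : R (1, 1) (1, 1) = 0) : R = crossOp (R (0, 1) (0, 1)).re (R (1, 0) (1, 0)).re
      (R (0, 0) (1, 1)) (R (0, 1) (1, 0)) := by
  obtain ⟨a1, a2, a3, a4⟩ := h.apply_eq_zero h0 1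
  obtain ⟨b1, b2, b3, b4⟩ := h.apply_eq_zero h1 0
  have d : ∀ p, R p p = (R p p).re := fun p => Complex.ext rfl (by simpa using (h.diag_nonneg p).2)
  have e1 := (h.1.apply (1, 1) (0, 0)).symm
  have e2 := (h.1.apply (1, 0) (0, 1)).symm
  ext ⟨i, j⟩ ⟨k, l⟩
  fin_cases i <;> fin_cases j <;> fin_cases k <;> fin_cases l <;> simp [crossOp, a1, a2, a3, a4, b1, b2, b3, b4, h0, h1] <;>
    first | exact d _ | simpa using e1 | simpa using e2

lemma forall_zero_conj {R : Op} {A B : Matrix (Fin 2) (Fin 2) ℂ} (hA : A.det ≠ 0) (hB : B.det ≠ 0)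
    (h : ∀ ν : Fin 2 → ℂ, ν ≠ 0 → ∃ φ, φ ≠ 0 ∧ expect R (prodVec φ ν) = 0) :
    ∀ ν : Fin 2 → ℂ, ν ≠ 0 → ∃ φ, φ ≠ 0 ∧
      expect ((A ⊗ₖ B)ᴴ * R * (A ⊗ₖ B)) (prodVec φ ν) = 0 := by
  intro ν hν
  obtain ⟨φ, hφ, h0⟩ := h (B *ᵥ ν) (mulVec_ne_zero hB hν)
  refine ⟨A⁻¹ *ᵥ φ, mulVec_ne_zero (isUnit_nonsing_inv_det A hA.isUnit).ne_zero hφ, ?_⟩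
  rw [expect_conj, kronecker_mulVec_prodVec, mulVec_mulVec, mul_nonsing_inv _ hA.isUnit, one_mulVec,
    h0]

lemma forall_zero_of_conj {R : Op} {A B : Matrix (Fin 2) (Fin 2) ℂ} (hA : A.det ≠ 0)
    (hB : B.det ≠ 0) (h : ∀ ν : Fin 2 → ℂ, ν ≠ 0 → ∃ φ, φ ≠ 0 ∧
      expect ((A ⊗ₖ B)ᴴ * R * (A ⊗ₖ B)) (prodVec φ ν) = 0) :
    ∀ ν : Fin 2 → ℂ, ν ≠ 0 → ∃ φ, φ ≠ 0 ∧ expect R (prodVec φ ν) = 0 := by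
  have := forall_zero_conj (isUnit_nonsing_inv_det A hA.isUnit).ne_zero
    (isUnit_nonsing_inv_det B hB.isUnit).ne_zero h
  rwa [conj_kronecker_cancel hA hB] at this

lemma exists_frame {φ : Fin 2 → ℂ} (hφ : φ ≠ 0) :
    ∃ A : Matrix (Fin 2) (Fin 2) ℂ, A.det ≠ 0 ∧ A *ᵥ Pi.single 0 1 = φ := by
  refine ⟨!![φ 0, -star (φ 1); φ 1, star (φ 0)], ?_, ?_⟩
  · have : (!![φ 0, -star (φ 1); φ 1, star (φ 0)]).det = (nsq φ : ℂ) := by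
      rw [det_fin_two_of, nsq]; push_cast
      rw [Complex.normSq_eq_conj_mul_self, Complex.normSq_eq_conj_mul_self]
      simp; ring
    rw [this]
    exact_mod_cast (nsq_pos hφ).ne'
  · ext i; fin_cases i <;> simp

/-- In an exhausted operator every vector of Bob occurs in a zero. -/
lemma IsExhausted.exists_zero {R : Op} (h : IsExhausted R) :
    ∀ ν : Fin 2 → ℂ, ν ≠ 0 → ∃ φ, φ ≠ 0 ∧ expect R (prodVec φ ν) = 0 := by
  obtain ⟨φ, ν, hφ, hν, h0⟩ := h.hasZero
  obtain ⟨A, hA, rfl⟩ := exists_frame hφ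
  obtain ⟨B, hB, rfl⟩ := exists_frame hν
  rw [← kronecker_mulVec_prodVec, ← expect_conj, expect_single] at h0
  refine forall_zero_of_conj hA hB ?_
  have h' := h.conj hA hB
  clear h
  generalize (A ⊗ₖ B)ᴴ * R * (A ⊗ₖ B) = R' at *
  obtain ⟨X, Y, hXY⟩ := h'.exists_second_zero h0
  -- These shears fix `e₀` and send `e₁` to `(X, 1)`, so the first zero stays in place while the
  -- second moves to `e₁ ⊗ e₁`.
  have hd : ∀ X : ℂ, (!![1, X; 0, 1]).det ≠ 0 := fun X => by simp [det_fin_two_of]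
  have e0 : ∀ X : ℂ, !![1, X; 0, 1] *ᵥ Pi.single 0 1 = Pi.single 0 1 := fun X => by
    ext i; fin_cases i <;> simp
  have e1 : ∀ X : ℂ, !![1, X; 0, 1] *ᵥ Pi.single 1 1 = ![X, 1] := fun X => by
    ext i; fin_cases i <;> simp
  refine forall_zero_of_conj (hd X) (hd Y) ?_
  have h'' := h'.conj (hd X) (hd Y)
  replace h0 : expect R' (prodVec (!![1, X; 0, 1] *ᵥ Pi.single 0 1)
      (!![1, Y; 0, 1] *ᵥ Pi.single 0 1)) = 0 := by rw [e0, e0, expect_single, h0]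
  replace hXY : expect R' (prodVec (!![1, X; 0, 1] *ᵥ Pi.single 1 1)
      (!![1, Y; 0, 1] *ᵥ Pi.single 1 1)) = 0 := by rw [e1, e1, hXY]
  rw [← kronecker_mulVec_prodVec, ← expect_conj, expect_single] at h0 hXY
  have e := eq_crossOp h''.1 h0 hXY
  rw [e] at h'' ⊢
  exact fun ν hν => exists_zero_of_crossOp h'' hν

end TwoQubit

end

theorem theorem4 (W : TwoQubit.Op) (hW : TwoQubit.IsEntanglementWitness W) :
    (TwoQubit.IsOptimal W ↔
      TwoQubit.ellipsoid W = Metric.closedBall (0 : EuclideanSpace ℝ (Fin 3)) 1 ∧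
        TwoQubit.chirality W = 1) ∧
    (TwoQubit.IsWeaklyOptimal W ↔
      (TwoQubit.ellipsoid W ∩
        Metric.sphere (0 : EuclideanSpace ℝ (Fin 3)) 1).Nonempty) := by
  rw [TwoQubit.isOptimal_iff_isExhausted hW, TwoQubit.isWeaklyOptimal_iff hW,
    TwoQubit.hasZero_iff_ellipsoid hW]
  refine ⟨⟨fun h => ?_, fun h => TwoQubit.isExhausted_of_ellipsoid hW h.1 h.2⟩, Iff.rfl⟩
  exact TwoQubit.ellipsoid_of_forall_zero hW ((TwoQubit.isExhausted_canonical_iff hW).2 h).exists_zero
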